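/- All graphs are finite, simple and undirected. A \emph{plane drawing} of a graph represents its vertices by distinct points of the plane and each edge by a simple arc joining its ends, such that the interior of an arc contains no vertex and meets no other arc. A graph is \emph{outerplanar} if it has a plane drawing in which every vertex lies on the boundary of the unbounded face. It is a \emph{wing-1 graph} if it has a plane drawing (a \emph{wing-1 drawing}) in which all vertices lie on a straight line and the interiors of all edges lie strictly on one and the same side of that line. In a wing-1 drawing, the first and the last vertex on the line are the \emph{end-vertices}, and a vertex is an \emph{outer-vertex} if it is exposed to the side on which the edges are drawn, i.e. if it lies on the boundary of the unbounded region that remains of the open half-plane on that side after removing the drawing. An $H$-minor of $G$ is given by pairwise disjoint non-empty connected vertex sets (branch sets) of $G$, one for each vertex of $H$, such that $G$ has an edge between the branch sets of any two adjacent vertices of $H$. A set $U\subseteq V(G)$ is a \emph{perimeter trace} of an outerplanar graph $G$ if (1) $G$ has no $K_3$-minor all three of whose branch sets meet $U$, and (2) $G$ has no $K_{2,2}$-minor such that the two branch sets of one of its two sides both meet $U$. We write a perimeter trace as $U=\{u_1,\dots,u_x\}$, listed in an order in which the vertices of each component of $G$ are consecutive and the vertices of $U$ in that component appear in the listed order on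 some path of $G$ (so, if $G$ is connected, $u_1,\dots,u_x$ appear in this order on a path of $G$). \textbf{Theorem.} Let $G$ be a finite graph. (a) $G$ is outerplanar if and only if $G$ is a wing-1 graph. (b) Let $G$ be outerplanar and let $U=\{u_1,\dots,u_x\}$ be a perimeter trace of $G$, listed as above. Then $G$ has a wing-1 drawing in which every vertex of $U$ is an outer-vertex, the vertices of $U$ occur on the line in the order $u_1,\dots,u_x$, the vertex $u_1$ (if $x\ge 1$) is one end-vertex, and the vertex $u_x$ (if $x\ge 2$) is the other end-vertex. -/

import Mathlib

open Set

/-- A drawing of a graph in the plane `ℂ` without edge crossings: distinct vertices are distinct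
points, every edge is a simple arc joining its two end-points, and the interior of an arc contains
no vertex and meets no other arc. -/
structure PlaneDrawing {V : Type*} (G : SimpleGraph V) where
  pos : V → ℂ
  curve : G.edgeSet → C(unitInterval, ℂ)
  pos_injective : Function.Injective pos
  curve_injective : ∀ e, Function.Injective (curve e)
  curve_ends : ∀ e, s(curve e 0, curve e 1) = Sym2.map pos (e : Sym2 V)
  no_vertex_inside : ∀ e, ∀ t ∈ Ioo (0 : unitInterval) 1, ∀ v, curve e t ≠ pos v
  no_crossing : ∀ e f, e ≠ f → ∀ t ∈ Ioo (0 : unitInterval) 1, ∀ s, curve e t ≠ curve f s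

/-- The union of the connected components of `W` that are unbounded. -/
def unboundedPart (W : Set ℂ) : Set ℂ :=
  {z | z ∈ W ∧ ¬ Bornology.IsBounded (connectedComponentIn W z)}

namespace PlaneDrawing

variable {V : Type*} {G : SimpleGraph V}

/-- The set of all points of the plane that are covered by the drawing. -/
def support (D : PlaneDrawing G) : Set ℂ :=
  range D.pos ∪ ⋃ e, range (D.curve e)

/-- The unbounded (outer) face of the drawing. -/
def outerFace (D : PlaneDrawing G) : Set ℂ :=
  unboundedPart D.supportᶜ

/-- Every vertex lies on the boundary of the outer face. -/
def IsOuterplanar (D : PlaneDrawing G) : Prop :=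
  ∀ v, D.pos v ∈ frontier D.outerFace

/-- All vertices lie on a straight line and all edges are drawn on one side of it. After a rigid
motion of the plane the line is the real axis and the side is the open upper half-plane. -/
def IsWing1 (D : PlaneDrawing G) : Prop :=
  (∀ v, (D.pos v).im = 0) ∧ ∀ e, ∀ t ∈ Ioo (0 : unitInterval) 1, 0 < (D.curve e t).im

/-- A vertex of a wing-1 drawing is outer when it is exposed to the side of the line on which the
edges are drawn: it lies on the boundary of the unbounded region that remains of the open upper
half-plane when the drawing is removed. -/
def IsOuterVertex (D : PlaneDrawing G) (v : V) : Prop :=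
  D.pos v ∈ frontier (unboundedPart ({z : ℂ | 0 < z.im} \ D.support))

/-- `v` is the first (leftmost) vertex on the line: one of the two end-vertices. -/
def IsFirst (D : PlaneDrawing G) (v : V) : Prop :=
  ∀ w, (D.pos v).re ≤ (D.pos w).re

/-- `v` is the last (rightmost) vertex on the line: the other end-vertex. -/
def IsLast (D : PlaneDrawing G) (v : V) : Prop :=
  ∀ w, (D.pos w).re ≤ (D.pos v).re

end PlaneDrawing

/-- A graph is outerplanar if it has a crossing-free drawing in the plane with all vertices on the
boundary of the outer face. -/
def IsOuterplanarGraph {V : Type*} (G : SimpleGraph V) : Prop :=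
  ∃ D : PlaneDrawing G, D.IsOuterplanar

/-- A graph is wing-1 if it has a crossing-free drawing with all vertices on a straight line and
all edges on one side of the line. -/
def IsWing1Graph {V : Type*} (G : SimpleGraph V) : Prop :=
  ∃ D : PlaneDrawing G, D.IsWing1

/-- The sets `S i` are the branch sets of an `H`-minor of `G`: non-empty, connected, pairwise
disjoint, and joined by an edge of `G` for every edge of `H`. -/
def IsMinorModel {ι V : Type*} (H : SimpleGraph ι) (G : SimpleGraph V) (S : ι → Set V) : Prop :=
  (∀ i, (G.induce (S i)).Connected) ∧
  (∀ i j, i ≠ j → Disjoint (S i) (S j)) ∧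
  (∀ i j, H.Adj i j → ∃ a ∈ S i, ∃ b ∈ S j, G.Adj a b)

/-- `U` is a perimeter trace of `G`: there is no `K₃` minor on `U` (all three branch sets meet
`U`), and no `K₂,₂` minor whose two upper branch sets both meet `U` or whose two lower branch sets
both meet `U`. -/
def IsPerimeterTrace {V : Type*} (G : SimpleGraph V) (U : Set V) : Prop :=
  (¬ ∃ S : Fin 3 → Set V, IsMinorModel (⊤ : SimpleGraph (Fin 3)) G S ∧ ∀ i, (S i ∩ U).Nonempty) ∧
  (¬ ∃ S : Fin 2 ⊕ Fin 2 → Set V, IsMinorModel (completeBipartiteGraph (Fin 2) (Fin 2)) G S ∧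
    ((∀ i, (S (Sum.inl i) ∩ U).Nonempty) ∨ (∀ j, (S (Sum.inr j) ∩ U).Nonempty)))

/-- The vertices of the list `L` are listed component by component (in any order of the
components), and those in one component appear in the listed order on a path of `G`. For a
connected graph this says that `L` appears in order on a path. -/
def AppearsInOrder {V : Type*} (G : SimpleGraph V) (L : List V) : Prop :=
  ∃ Ls : List (List V), Ls.flatten = L ∧
    (∀ l ∈ Ls, ∃ (a b : V) (p : G.Walk a b), p.IsPath ∧ l.Sublist p.support) ∧
    Ls.Pairwise (fun l l' => ∀ x ∈ l, ∀ y ∈ l', ¬ G.Reachable x y)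

/-!
The proof passes from drawings to excluded minors and back.

*From an outerplanar drawing to excluded minors.* For two disjoint curves `γ`, `δ` in the plane, a
continuous logarithm of `γ s - δ t` on the parameter square relates the angles swept by `γ` as seen
from the ends of `δ` to those swept by `δ` as seen from the ends of `γ` (`logChange_square`). In an
outerplanar drawing every vertex can escape to infinity through the outer face, and therefore the
direction from one vertex to another has a single-valued logarithm
(`PlaneDrawing.IsOuterplanar.exists_logarithm`). Comparing the directions from `a` to `b` and from
`b` to `a` gives an odd integer `o a b = - o b a`, and disjoint edges `p q` and `r s` yield the
linear relation `o q s - o q r - o p s + o p r = 0`. The relation telescopes along walks and hence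
holds for disjoint connected sets. For the branch vertices of a `K₄` or `K₂,₃` minor, these
relations contradict the parity (`PlaneDrawing.IsOuterplanar.outerplanarMinorFree`). No form of the
Jordan curve theorem is needed.

*From excluded minors to a layout on a line.* A layout is an order of the vertices in which no two
edges have interlacing ends. Two vertices `s`, `t` of a vertex set can be made its first and last
vertex if there is no `K₂,₂` minor of which one side is rooted at `s` and `t`: growing disjoint
connected sets around `s` and `t` as far as possible leads to a cut vertex between `s` and `t`, to
a separation, or to such a rooted minor (`SimpleGraph.exists_layout_of_noRootedSquare`). When only
`s` is prescribed, a suitable `t` exists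
(`SimpleGraph.OuterplanarMinorFree.exists_noRootedSquare`). For a perimeter trace listed in order,
each vertex separates the earlier from the later ones
(`IsPerimeterTrace.mem_of_sublist`), so the layouts between consecutive vertices can be
concatenated (`SimpleGraph.OuterplanarMinorFree.exists_layout_of_list`).

*From a layout to a drawing.* Each edge is drawn as the parabola `y = (x - p) (q - x)` over its
interval `[p, q]`. Parabolas over nested intervals lie strictly above one another, and a vertex over
which no edge passes is exposed along the vertical ray above it. Conversely, a wing-1 drawing leaves
a half-plane free, so that all its vertices lie on the outer face. Part (a) is then the case of the
empty perimeter trace.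
-/

/-! ### Changes of logarithm along curves -/

/-- The change of a continuous logarithm along the curve `c`: the difference `g 1 - g 0` for any
continuous `g` with `exp ∘ g = c`. It is `0` if there is no such `g`. -/
noncomputable def logChange (c : unitInterval → ℂ) : ℂ :=
  open Classical in
  if h : ∃ g : C(unitInterval, ℂ), ∀ t, Complex.exp (g t) = c t then
    h.choose 1 - h.choose 0 else 0

instance : ContractibleSpace unitInterval :=
  (convex_Icc (0 : ℝ) 1).contractibleSpace ⟨0, by simp⟩

instance : LocallyPathConnectedSpace unitInterval :=
  (convex_Icc (0 : ℝ) 1).locallyPathConnectedSpace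

lemma exists_continuous_log {A : Type*} [TopologicalSpace A] [SimplyConnectedSpace A]
    [LocallyPathConnectedSpace A] (F : C(A, ℂ)) (hF : ∀ x, F x ≠ 0) :
    ∃ g : C(A, ℂ), ∀ x, Complex.exp (g x) = F x := by
  obtain ⟨a⟩ : Nonempty A := inferInstance
  obtain ⟨g, ⟨-, hg⟩, -⟩ := Complex.isCoveringMapOn_exp.existsUnique_continuousMap_lifts F
    (a₀ := a) (Complex.exp_log (hF a)) (fun x => by simpa using hF x)
  exact ⟨g, fun x => congrFun hg x⟩

lemma logChange_eq {c : unitInterval → ℂ} (g : C(unitInterval, ℂ))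
    (hg : ∀ t, Complex.exp (g t) = c t) : logChange c = g 1 - g 0 := by
  have h : ∃ g : C(unitInterval, ℂ), ∀ t, Complex.exp (g t) = c t := ⟨g, hg⟩
  rw [logChange, dif_pos h]
  set k := h.choose
  have hk : ∀ t, Complex.exp (k t) = c t := h.choose_spec
  -- Two continuous logarithms that agree at `0` agree everywhere.
  set k' : C(unitInterval, ℂ) := k + ContinuousMap.const _ (g 0 - k 0) with hk'
  have e0 : Complex.exp (g 0 - k 0) = 1 := by
    rw [Complex.exp_sub, hg, hk, div_self]
    rw [← hg]; exact Complex.exp_ne_zero _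
  have hk'' : ∀ t, Complex.exp (k' t) = c t := by
    intro t
    simp [hk', Complex.exp_add, e0, hk]
  have hc : Continuous c := by
    have : c = fun t => Complex.exp (g t) := funext fun t => (hg t).symm
    rw [this]; fun_prop
  have key := Complex.isCoveringMapOn_exp.existsUnique_continuousMap_lifts ⟨c, hc⟩
    (a₀ := 0) (hg 0) (fun x => by
      change c x ∈ _
      rw [← hg]; simp)
  have : g = k' := key.unique ⟨rfl, funext hg⟩ ⟨by simp [hk'], funext hk''⟩
  rw [this]
  simp [hk']
  ring

lemma exp_logChange {c : unitInterval → ℂ} (hc : Continuous c) (h : ∀ t, c t ≠ 0) :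
    Complex.exp (logChange c) = c 1 / c 0 := by
  obtain ⟨g, hg⟩ := exists_continuous_log ⟨c, hc⟩ h
  rw [logChange_eq (c := c) g hg, Complex.exp_sub, hg, hg]
  rfl

/-- For two disjoint curves, the angle swept by `γ` as seen from the end of `δ` minus that seen
from the start of `δ` equals the same expression with the two curves exchanged: both are the
total change of a logarithm of `γ s - δ t` on the parameter square. -/
lemma logChange_square {γ δ : unitInterval → ℂ} (hγ : Continuous γ) (hδ : Continuous δ)
    (h : ∀ s t, γ s ≠ δ t) :
    logChange (fun s => γ s - δ 1) - logChange (fun s => γ s - δ 0) =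
      logChange (fun t => δ t - γ 1) - logChange (fun t => δ t - γ 0) := by
  obtain ⟨g, hg⟩ := exists_continuous_log
    (⟨fun p : unitInterval × unitInterval => γ p.1 - δ p.2, by fun_prop⟩ : C(_, ℂ))
    (fun p => sub_ne_zero.2 (h _ _))
  have hg : ∀ s t, Complex.exp (g (s, t)) = γ s - δ t := fun s t => hg (s, t)
  have h1 : ∀ t, logChange (fun s => γ s - δ t) = g (1, t) - g (0, t) := fun t =>
    logChange_eq (⟨fun s => g (s, t), by fun_prop⟩ : C(unitInterval, ℂ)) fun s => hg s t
  have h2 : ∀ s, logChange (fun t => δ t - γ s) = g (s, 1) - g (s, 0) := by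
    intro s
    -- The difference `δ t - γ s` is the opposite of `γ s - δ t`, so its logarithm is shifted by `π i`.
    rw [logChange_eq (⟨fun t => g (s, t) + Real.pi * Complex.I, by fun_prop⟩ : C(unitInterval, ℂ))
      fun t => ?_]
    · simp
    · simp [Complex.exp_add, hg]
  rw [h1, h1, h2, h2]
  ring

/-- Seen from a point `z` farther from the origin than all of `γ`, the curve `γ` stays in a
half-plane, where the principal logarithm can be used. -/
lemma logChange_of_norm_lt {γ : unitInterval → ℂ} (hγ : Continuous γ) {z : ℂ}
    (h : ∀ t, ‖γ t‖ < ‖z‖) :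
    logChange (fun t => γ t - z) = Complex.log (1 - γ 1 / z) - Complex.log (1 - γ 0 / z) := by
  have hz : z ≠ 0 := norm_pos_iff.1 ((norm_nonneg _).trans_lt (h 0))
  have hs : ∀ t, 1 - γ t / z ∈ Complex.slitPlane := by
    intro t
    left
    have : ‖γ t / z‖ < 1 := by
      rw [norm_div, div_lt_one (norm_pos_iff.2 hz)]; exact h t
    have := (Complex.re_le_norm (γ t / z)).trans_lt this
    simpa using this
  rw [logChange_eq (⟨fun t => Complex.log (1 - γ t / z) + Complex.log (-z), by
    refine (Continuous.clog (by fun_prop) hs).add continuous_const⟩ : C(unitInterval, ℂ))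
    fun t => ?_]
  · simp
  · simp only [ContinuousMap.coe_mk, Complex.exp_add]
    rw [Complex.exp_log (Complex.slitPlane_ne_zero (hs t)), Complex.exp_log (neg_ne_zero.2 hz)]
    field_simp
    ring

/-! ### The angles of an outerplanar drawing -/

namespace PlaneDrawing

variable {V : Type*} {G : SimpleGraph V} (D : PlaneDrawing G)

lemma exists_oriented_curve {a b : V} (h : G.Adj a b) :
    ∃ γ : unitInterval → ℂ, Continuous γ ∧ γ 0 = D.pos a ∧ γ 1 = D.pos b ∧
      range γ = range (D.curve ⟨s(a, b), h⟩) := by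
  set c := D.curve ⟨s(a, b), h⟩ with hc
  have := D.curve_ends ⟨s(a, b), h⟩
  rw [← hc] at this
  simp only [Sym2.map_mk, Sym2.eq_iff] at this
  rcases this with ⟨h0, h1⟩ | ⟨h0, h1⟩
  · exact ⟨c, c.continuous, h0, h1, rfl⟩
  · refine ⟨fun t => c (unitInterval.symm t), by fun_prop, by simp [h1], by simp [h0], ?_⟩
    exact unitInterval.symm_bijective.surjective.range_comp c

lemma curve_mem_cases (e : G.edgeSet) (t : unitInterval) :
    t ∈ Ioo (0 : unitInterval) 1 ∨ ∃ v ∈ (e : Sym2 V), D.curve e t = D.pos v := by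
  rcases eq_or_ne t 0 with rfl | h0
  · right
    have : D.curve e 0 ∈ Sym2.map D.pos (e : Sym2 V) := by
      rw [← D.curve_ends e]; simp
    obtain ⟨v, hv, h⟩ := Sym2.mem_map.1 this
    exact ⟨v, hv, h.symm⟩
  rcases eq_or_ne t 1 with rfl | h1
  · right
    have : D.curve e 1 ∈ Sym2.map D.pos (e : Sym2 V) := by
      rw [← D.curve_ends e]; simp
    obtain ⟨v, hv, h⟩ := Sym2.mem_map.1 this
    exact ⟨v, hv, h.symm⟩
  · exact Or.inl ⟨unitInterval.pos_iff_ne_zero.2 h0, unitInterval.lt_one_iff_ne_one.2 h1⟩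

lemma pos_notMem_range_curve {e : G.edgeSet} {v : V} (h : v ∉ (e : Sym2 V)) :
    D.pos v ∉ range (D.curve e) := by
  rintro ⟨t, ht⟩
  rcases D.curve_mem_cases e t with h' | ⟨w, hw, h'⟩
  · exact D.no_vertex_inside e t h' v ht
  · rw [ht] at h'
    exact h (D.pos_injective h' ▸ hw)

lemma disjoint_range_curve {e f : G.edgeSet} (h : ∀ v, v ∈ (e : Sym2 V) → v ∉ (f : Sym2 V)) :
    Disjoint (range (D.curve e)) (range (D.curve f)) := by
  rw [Set.disjoint_left]
  rintro _ ⟨s, rfl⟩ ⟨t, ht⟩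
  have hef : f ≠ e := by
    rintro rfl
    induction f with | _ f hf =>
    induction f with | _ a b =>
    exact h a (by simp) (by simp)
  rcases D.curve_mem_cases f t with h' | ⟨w, hw, h'⟩
  · exact D.no_crossing f e hef t h' s ht
  · exact D.pos_notMem_range_curve (fun hw' => h w hw' hw) ⟨s, ht.symm.trans h'⟩

lemma isCompact_support [Finite V] : IsCompact D.support :=
  (Set.finite_range D.pos).isCompact.union
    (isCompact_iUnion fun e => isCompact_range (D.curve e).continuous)

/-- The part of the drawing that is away from the vertex `v`: the other vertices and the edges
not incident with `v`. -/
def supportAway (v : V) : Set ℂ :=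
  (⋃ w : {w // w ≠ v}, {D.pos w}) ∪ ⋃ e : {e : G.edgeSet // v ∉ (e : Sym2 V)}, range (D.curve e)

lemma isClosed_supportAway [Finite V] (v : V) : IsClosed (D.supportAway v) :=
  (isClosed_iUnion_of_finite fun _ => isClosed_singleton).union
    (isClosed_iUnion_of_finite fun e => (isCompact_range (D.curve e.1).continuous).isClosed)

lemma supportAway_subset (v : V) : D.supportAway v ⊆ D.support := by
  rintro z (hz | hz)
  · obtain ⟨w, rfl⟩ := mem_iUnion.1 hz
    exact Or.inl ⟨_, rfl⟩
  · obtain ⟨e, he⟩ := mem_iUnion.1 hz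
    exact Or.inr (mem_iUnion.2 ⟨_, he⟩)

/-- In an outerplanar drawing a vertex can be moved arbitrarily far away without meeting the part
of the drawing away from it. -/
lemma IsOuterplanar.exists_escape [Finite V] {D : PlaneDrawing G} (hD : D.IsOuterplanar) (v : V)
    (R : ℝ) :
    ∃ ζ : unitInterval → ℂ, Continuous ζ ∧ ζ 0 = D.pos v ∧ R < ‖ζ 1‖ ∧
      ∀ t, ζ t ∉ D.supportAway v := by
  have hv : D.pos v ∉ D.supportAway v := by
    rintro (hz | hz)
    · obtain ⟨w, hw⟩ := mem_iUnion.1 hz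
      exact w.2 (D.pos_injective hw).symm
    · obtain ⟨e, he⟩ := mem_iUnion.1 hz
      exact D.pos_notMem_range_curve e.2 he
  obtain ⟨ε, hε, hball⟩ := Metric.isOpen_iff.1 (D.isClosed_supportAway v).isOpen_compl _ hv
  obtain ⟨z, ⟨hzW, hzU⟩, hz⟩ := Metric.mem_closure_iff.1 (frontier_subset_closure (hD v)) ε hε
  have hopen : IsOpen (connectedComponentIn D.supportᶜ z) :=
    D.isCompact_support.isClosed.isOpen_compl.connectedComponentIn
  obtain ⟨z₁, hz₁, hR⟩ : ∃ z₁ ∈ connectedComponentIn D.supportᶜ z, R < ‖z₁‖ := by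
    by_contra! hcon
    exact hzU ((Metric.isBounded_iff_subset_closedBall 0).2 ⟨R, fun x hx => by
      simpa using hcon x hx⟩)
  have j1 : JoinedIn (D.supportAway v)ᶜ (D.pos v) z :=
    (((convex_ball (D.pos v) ε).isPathConnected ⟨_, Metric.mem_ball_self hε⟩).joinedIn _
      (Metric.mem_ball_self hε) _ (by rwa [Metric.mem_ball'])).mono hball
  have j2 : JoinedIn (D.supportAway v)ᶜ z z₁ := by
    have hp : IsPathConnected (connectedComponentIn D.supportᶜ z) :=
      hopen.isConnected_iff_isPathConnected.1 (isConnected_connectedComponentIn_iff.2 hzW)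
    refine (hp.joinedIn _ (mem_connectedComponentIn hzW) _ hz₁).mono ?_
    exact (connectedComponentIn_subset _ _).trans (compl_subset_compl.2 (D.supportAway_subset v))
  obtain ⟨p, hp⟩ := j1.trans j2
  exact ⟨p, p.continuous, p.source, by simpa using hR, hp⟩

/-- In an outerplanar drawing the direction from `v` to `w` has a logarithm `φ v w` that is
single-valued in the following sense: along every edge that avoids `v` it changes continuously.
The logarithm is pinned down by letting `v` escape to infinity. -/
lemma IsOuterplanar.exists_logarithm [Finite V] {D : PlaneDrawing G} (hD : D.IsOuterplanar) :
    ∃ φ : V → V → ℂ, (∀ v w, v ≠ w → Complex.exp (φ v w) = D.pos w - D.pos v) ∧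
      ∀ a b v, ∀ h : G.Adj a b, v ≠ a → v ≠ b → ∀ γ : unitInterval → ℂ, Continuous γ →
        γ 0 = D.pos a → γ 1 = D.pos b → range γ = range (D.curve ⟨s(a, b), h⟩) →
        logChange (fun t => γ t - D.pos v) = φ v b - φ v a := by
  obtain ⟨R, hR⟩ := D.isCompact_support.isBounded.exists_norm_le
  choose ζ hζ hζ0 hζ1 hζa using fun v => hD.exists_escape v R
  refine ⟨fun v w => Complex.log (1 - D.pos w / ζ v 1) + Complex.log (-ζ v 1) -
    logChange (fun t => ζ v t - D.pos w), fun v w hvw => ?_, fun a b v h hva hvb γ hγ h0 h1 hr => ?_⟩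
  · have hw : ‖D.pos w‖ < ‖ζ v 1‖ := (hR _ (Or.inl ⟨w, rfl⟩)).trans_lt (hζ1 v)
    have hz : ζ v 1 ≠ 0 := norm_pos_iff.1 ((norm_nonneg _).trans_lt hw)
    have hne : ζ v 1 - D.pos w ≠ 0 := by
      rw [sub_ne_zero]; rintro he; rw [he] at hw; exact lt_irrefl _ hw
    have hne' : D.pos v - D.pos w ≠ 0 := sub_ne_zero.2 fun he => hvw (D.pos_injective he)
    have hne'' : 1 - D.pos w / ζ v 1 ≠ 0 := by
      rw [one_sub_div hz]; exact div_ne_zero hne hz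
    rw [Complex.exp_sub, Complex.exp_add, Complex.exp_log hne'', Complex.exp_log (neg_ne_zero.2 hz),
      exp_logChange (by have := hζ v; fun_prop), hζ0]
    · field_simp
      ring
    · intro t he
      exact hζa v t (Or.inl (mem_iUnion.2 ⟨⟨w, hvw.symm⟩, sub_eq_zero.1 he⟩))
  · have hmem : ∀ t, γ t ∈ range (D.curve ⟨s(a, b), h⟩) := fun t => hr ▸ ⟨t, rfl⟩
    have hsq := logChange_square hγ (hζ v) fun s t he => hζa v t (he ▸
      Or.inr (mem_iUnion.2 ⟨⟨⟨s(a, b), h⟩, by simp [hva, hvb]⟩, hmem s⟩))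
    have hfar := logChange_of_norm_lt hγ (z := ζ v 1) fun t =>
      (hR _ (Or.inr (mem_iUnion.2 ⟨_, hmem t⟩))).trans_lt (hζ1 v)
    rw [hζ0, h0, h1] at hsq
    rw [h0, h1] at hfar
    linear_combination hfar - hsq

/-- The combinatorial content of an outerplanar drawing. The integer `o a b` is the turn, in half
turns, between the single-valued directions from `a` to `b` and from `b` to `a`; hence it is odd,
and it satisfies a linear relation for every pair of disjoint edges. -/
lemma IsOuterplanar.exists_turning [Finite V] {D : PlaneDrawing G} (hD : D.IsOuterplanar) :
    ∃ o : V → V → ℤ, (∀ a b, a ≠ b → Odd (o a b)) ∧ (∀ a b, o b a = - o a b) ∧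
      ∀ p q r s, G.Adj p q → G.Adj r s → p ≠ r → p ≠ s → q ≠ r → q ≠ s →
        o q s - o q r - o p s + o p r = 0 := by
  obtain ⟨φ, hφ, hφe⟩ := hD.exists_logarithm
  have hI : (Real.pi * Complex.I : ℂ) ≠ 0 := by simp [Real.pi_ne_zero]
  have key : ∀ a b, ∃ o : ℤ, a ≠ b → Odd o ∧ φ a b - φ b a = o * (Real.pi * Complex.I) := by
    intro a b
    by_cases hab : a = b
    · exact ⟨0, fun h => absurd hab h⟩
    have h0 : D.pos b - D.pos a ≠ 0 := sub_ne_zero.2 fun he => hab (D.pos_injective he).symm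
    have : Complex.exp (φ a b - φ b a) = Complex.exp (Real.pi * Complex.I) := by
      rw [Complex.exp_sub, hφ a b hab, hφ b a (Ne.symm hab), Complex.exp_pi_mul_I,
        ← neg_sub (D.pos b), div_neg, div_self h0]
    obtain ⟨n, hn⟩ := Complex.exp_eq_exp_iff_exists_int.1 this
    refine ⟨2 * n + 1, fun _ => ⟨⟨n, rfl⟩, ?_⟩⟩
    rw [hn]; push_cast; ring
  choose k hk using key
  have hk2 : ∀ a b, a ≠ b → (k b a : ℂ) = - k a b := by
    intro a b hab
    have h1 := (hk a b hab).2
    have h2 := (hk b a (Ne.symm hab)).2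
    refine mul_right_cancel₀ hI ?_
    linear_combination -h1 - h2
  classical
  refine ⟨fun a b => if a = b then 0 else k a b, fun a b hab => ?_, fun a b => ?_, ?_⟩
  · simpa [hab] using (hk a b hab).1
  · by_cases hab : a = b
    · simp [hab]
    · simp only [hab, Ne.symm hab, if_false]
      exact_mod_cast hk2 a b hab
  · intro p q r s hpq hrs hpr hps hqr hqs
    simp only [hpr, hps, hqr, hqs, if_false]
    obtain ⟨γ, hγ, hγ0, hγ1, hγr⟩ := D.exists_oriented_curve hpq
    obtain ⟨δ, hδ, hδ0, hδ1, hδr⟩ := D.exists_oriented_curve hrs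
    have hdis := D.disjoint_range_curve (e := ⟨s(p, q), hpq⟩) (f := ⟨s(r, s), hrs⟩) (by
      intro v hv hv'
      simp only [Sym2.mem_iff] at hv hv'
      grind)
    rw [← hγr, ← hδr, Set.disjoint_left] at hdis
    have hsq := logChange_square hγ hδ fun s t he => hdis ⟨s, rfl⟩ ⟨t, he.symm⟩
    rw [hγ0, hγ1, hδ0, hδ1, hφe p q s hpq (Ne.symm hps) (Ne.symm hqs) γ hγ hγ0 hγ1 hγr,
      hφe p q r hpq (Ne.symm hpr) (Ne.symm hqr) γ hγ hγ0 hγ1 hγr,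
      hφe r s q hrs hqr hqs δ hδ hδ0 hδ1 hδr, hφe r s p hrs hpr hps δ hδ hδ0 hδ1 hδr] at hsq
    have e1 := (hk q s hqs).2
    have e2 := (hk q r hqr).2
    have e3 := (hk p s hps).2
    have e4 := (hk p r hpr).2
    have : ((k q s - k q r - k p s + k p r : ℤ) : ℂ) = 0 := by
      refine mul_right_cancel₀ hI ?_
      push_cast
      linear_combination -hsq - e1 + e2 + e3 - e4
    exact_mod_cast this

end PlaneDrawing

/-! ### Connected vertex sets and small minors -/

namespace SimpleGraph

variable {V : Type*} {G : SimpleGraph V}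

/-- The vertex set `S` is non-empty and induces a connected subgraph. -/
abbrev ConnectedOn (G : SimpleGraph V) (S : Set V) : Prop := (G.induce S).Connected

/-- Some edge of `G` joins `X` to `Y`. -/
def Linked (G : SimpleGraph V) (X Y : Set V) : Prop := ∃ x ∈ X, ∃ y ∈ Y, G.Adj x y

lemma Linked.symm {X Y : Set V} (h : G.Linked X Y) : G.Linked Y X := by
  obtain ⟨x, hx, y, hy, h⟩ := h
  exact ⟨y, hy, x, hx, h.symm⟩

lemma Linked.mono {X Y X' Y' : Set V} (h : G.Linked X Y) (hX : X ⊆ X') (hY : Y ⊆ Y') :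
    G.Linked X' Y' := by
  obtain ⟨x, hx, y, hy, h⟩ := h
  exact ⟨x, hX hx, y, hY hy, h⟩

lemma Linked.of_union {X Y Z : Set V} (h : G.Linked X (Y ∪ Z)) : G.Linked X Y ∨ G.Linked X Z := by
  obtain ⟨x, hx, y, hy | hy, h⟩ := h
  · exact Or.inl ⟨x, hx, y, hy, h⟩
  · exact Or.inr ⟨x, hx, y, hy, h⟩

lemma connectedOn_singleton (v : V) : G.ConnectedOn {v} :=
  ⟨fun a b => by rw [Subsingleton.elim a b]⟩

lemma ConnectedOn.union {X Y : Set V} (hX : G.ConnectedOn X) (hY : G.ConnectedOn Y)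
    (h : G.Linked X Y) : G.ConnectedOn (X ∪ Y) := by
  obtain ⟨x, hx, y, hy, h⟩ := h
  exact connected_induce_union hX.preconnected hY.preconnected hx hy h

lemma ConnectedOn.insert_of_adj {X : Set V} (hX : G.ConnectedOn X) {x y : V} (hx : x ∈ X)
    (h : G.Adj x y) : G.ConnectedOn (insert y X) := by
  rw [← Set.union_singleton]
  exact hX.union (connectedOn_singleton y) ⟨x, hx, y, rfl, h⟩

lemma ConnectedOn.exists_boundary {C X : Set V} (hC : G.ConnectedOn C) {a b : V} (ha : a ∈ C)
    (haX : a ∈ X) (hb : b ∈ C) (hbX : b ∉ X) :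
    ∃ x ∈ C, ∃ y ∈ C, x ∈ X ∧ y ∉ X ∧ G.Adj x y := by
  obtain ⟨p⟩ := hC.preconnected ⟨a, ha⟩ ⟨b, hb⟩
  obtain ⟨d, -, h1, h2⟩ := p.exists_boundary_dart (Subtype.val ⁻¹' X) haX hbX
  exact ⟨d.fst, d.fst.2, d.snd, d.snd.2, h1, h2, d.adj⟩

lemma exists_maximum_of_finite {α : Type*} [Finite α] {P : α → Prop} (f : α → ℕ) {a : α}
    (ha : P a) : ∃ a, P a ∧ ∀ b, P b → f b ≤ f a := by
  have : Nonempty {a // P a} := ⟨⟨a, ha⟩⟩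
  obtain ⟨m, hm⟩ := Finite.exists_max fun x : {a // P a} => f x
  exact ⟨m, m.2, fun b hb => hm ⟨b, hb⟩⟩

/-- Disjoint connected subsets of a connected set extend to a partition of it into two connected
sets. -/
lemma ConnectedOn.exists_partition [Finite V] {C X Z : Set V} (hC : G.ConnectedOn C)
    (hX : G.ConnectedOn X) (hZ : G.ConnectedOn Z) (hXC : X ⊆ C) (hZC : Z ⊆ C)
    (hXZ : Disjoint X Z) :
    ∃ X' Z', X ⊆ X' ∧ Z ⊆ Z' ∧ G.ConnectedOn X' ∧ G.ConnectedOn Z' ∧ Disjoint X' Z' ∧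
      X' ∪ Z' = C ∧ G.Linked X' Z' := by
  obtain ⟨⟨X', Z'⟩, ⟨h1, h2, h3, h4, h5, h6⟩, hmax⟩ := exists_maximum_of_finite
    (P := fun p : Set V × Set V => X ⊆ p.1 ∧ Z ⊆ p.2 ∧ G.ConnectedOn p.1 ∧ G.ConnectedOn p.2 ∧
      Disjoint p.1 p.2 ∧ p.1 ∪ p.2 ⊆ C) (fun p => p.1.ncard + p.2.ncard)
    (a := (X, Z)) ⟨subset_rfl, subset_rfl, hX, hZ, hXZ, union_subset hXC hZC⟩
  simp only at h1 h2 h3 h4 h5 h6 hmax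
  have hcov : X' ∪ Z' = C := by
    refine h6.antisymm fun c hc => ?_
    by_contra hcn
    obtain ⟨⟨a, ha⟩⟩ := h3.nonempty
    obtain ⟨x, -, y, hy, hxX, hyX, hxy⟩ := hC.exists_boundary (h6 (Or.inl ha)) (Or.inl ha) hc hcn
    rw [Set.disjoint_left] at h5
    rcases hxX with hx | hx
    · have := hmax (insert y X', Z') ⟨h1.trans (subset_insert _ _), h2, h3.insert_of_adj hx hxy, h4,
        by rw [Set.disjoint_left]; grind, by grind⟩
      dsimp only at this
      rw [Set.ncard_insert_of_notMem (s := X') (fun h => hyX (Or.inl h))] at this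
      omega
    · have := hmax (X', insert y Z') ⟨h1, h2.trans (subset_insert _ _), h3, h4.insert_of_adj hx hxy,
        by rw [Set.disjoint_left]; grind, by grind⟩
      dsimp only at this
      rw [Set.ncard_insert_of_notMem (s := Z') (fun h => hyX (Or.inr h))] at this
      omega
  refine ⟨X', Z', h1, h2, h3, h4, h5, hcov, ?_⟩
  obtain ⟨⟨a, ha⟩⟩ := h3.nonempty
  obtain ⟨⟨b, hb⟩⟩ := h4.nonempty
  obtain ⟨x, -, y, hy, hxX, hyX, hxy⟩ := hC.exists_boundary (h6 (Or.inl ha)) ha (h6 (Or.inr hb))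
    (fun h => Set.disjoint_left.1 h5 h hb)
  exact ⟨x, hxX, y, by grind, hxy⟩

/-- `G` has neither a `K₄` minor nor a `K₂,₃` minor. -/
def OuterplanarMinorFree (G : SimpleGraph V) : Prop :=
  (¬ ∃ S : Fin 4 → Set V, IsMinorModel (⊤ : SimpleGraph (Fin 4)) G S) ∧
  ¬ ∃ S : Fin 2 ⊕ Fin 3 → Set V, IsMinorModel (completeBipartiteGraph (Fin 2) (Fin 3)) G S

lemma OuterplanarMinorFree.false_of_k4 (hG : G.OuterplanarMinorFree) {X Y Z W : Set V}
    (hX : G.ConnectedOn X) (hY : G.ConnectedOn Y) (hZ : G.ConnectedOn Z) (hW : G.ConnectedOn W)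
    (hXY : Disjoint X Y) (hXZ : Disjoint X Z) (hXW : Disjoint X W) (hYZ : Disjoint Y Z)
    (hYW : Disjoint Y W) (hZW : Disjoint Z W)
    (lXY : G.Linked X Y) (lXZ : G.Linked X Z) (lXW : G.Linked X W) (lYZ : G.Linked Y Z)
    (lYW : G.Linked Y W) (lZW : G.Linked Z W) : False := by
  refine hG.1 ⟨![X, Y, Z, W], ?_, ?_, ?_⟩
  · intro i
    fin_cases i <;> assumption
  · intro i j hij
    fin_cases i <;> fin_cases j <;>
      first | exact absurd rfl hij | assumption | (apply Disjoint.symm; assumption)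
  · intro i j hij
    have hij := hij.ne
    fin_cases i <;> fin_cases j <;>
      first | exact absurd rfl hij | assumption | (apply Linked.symm; assumption)

/-- The `K₂,₃` minor has the sides `X, Y` and `P, Q, R`. -/
lemma OuterplanarMinorFree.false_of_k23 (hG : G.OuterplanarMinorFree) {X Y P Q R : Set V}
    (hX : G.ConnectedOn X) (hY : G.ConnectedOn Y) (hP : G.ConnectedOn P) (hQ : G.ConnectedOn Q)
    (hR : G.ConnectedOn R) (hXY : Disjoint X Y) (hXP : Disjoint X P) (hXQ : Disjoint X Q)
    (hXR : Disjoint X R) (hYP : Disjoint Y P) (hYQ : Disjoint Y Q) (hYR : Disjoint Y R)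
    (hPQ : Disjoint P Q) (hPR : Disjoint P R) (hQR : Disjoint Q R)
    (lXP : G.Linked X P) (lXQ : G.Linked X Q) (lXR : G.Linked X R) (lYP : G.Linked Y P)
    (lYQ : G.Linked Y Q) (lYR : G.Linked Y R) : False := by
  refine hG.2 ⟨Sum.elim ![X, Y] ![P, Q, R], ?_, ?_, ?_⟩
  · rintro (i | i) <;> fin_cases i <;> assumption
  · rintro (i | i) (j | j) hij <;> fin_cases i <;> fin_cases j <;>
      first | exact absurd rfl hij | assumption | (apply Disjoint.symm; assumption)
  · rintro (i | i) (j | j) hij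
    · simp [completeBipartiteGraph] at hij
    · fin_cases i <;> fin_cases j <;> assumption
    · fin_cases i <;> fin_cases j <;> (apply Linked.symm; assumption)
    · simp [completeBipartiteGraph] at hij

end SimpleGraph

namespace PlaneDrawing

open SimpleGraph

variable {V : Type*} {G : SimpleGraph V}

/-- The linear relation of a turning function passes from disjoint edges to disjoint connected
sets, as it telescopes along walks. -/
lemma turning_connectedOn {o : V → V → ℤ}
    (ho : ∀ p q r s, G.Adj p q → G.Adj r s → p ≠ r → p ≠ s → q ≠ r → q ≠ s →
        o q s - o q r - o p s + o p r = 0) {A B : Set V} (hA : G.ConnectedOn A)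
    (hB : G.ConnectedOn B) (hAB : Disjoint A B) {p q r s : V} (hp : p ∈ A) (hq : q ∈ A)
    (hr : r ∈ B) (hs : s ∈ B) : o q s - o q r - o p s + o p r = 0 := by
  have hne : ∀ a : A, ∀ b : B, (a : V) ≠ b := fun a b h =>
    Set.disjoint_left.1 hAB a.2 (h ▸ b.2)
  have key1 : ∀ (a a' : A), G.Adj a a' → ∀ (r s : B) (w : (G.induce B).Walk r s),
      o a' s - o a' r - o a s + o a r = 0 := by
    intro a a' h r s w
    induction w with
    | nil => ring
    | @cons r m s h' w ih =>
      have := ho a a' r m h h' (hne _ _) (hne _ _) (hne _ _) (hne _ _)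
      linarith
  obtain ⟨w⟩ := hB.preconnected ⟨r, hr⟩ ⟨s, hs⟩
  have key2 : ∀ (p q : A) (w : (G.induce A).Walk p q), o q s - o q r - o p s + o p r = 0 := by
    intro p q w'
    induction w' with
    | nil => ring
    | @cons p m q h' w' ih =>
      have := key1 p m h' ⟨r, hr⟩ ⟨s, hs⟩ w
      linarith
  obtain ⟨w'⟩ := hA.preconnected ⟨p, hp⟩ ⟨q, hq⟩
  exact key2 _ _ w'

/-- An outerplanar graph has no `K₄` minor and no `K₂,₃` minor: the linear relations between the
turning numbers of the branch vertices contradict their being odd. -/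
theorem IsOuterplanar.outerplanarMinorFree [Finite V] {D : PlaneDrawing G}
    (hD : D.IsOuterplanar) : G.OuterplanarMinorFree := by
  obtain ⟨o, hodd, hanti, ho⟩ := hD.exists_turning
  constructor
  · rintro ⟨S, (hS : ∀ i, G.ConnectedOn (S i)), hdis, hadj⟩
    choose r hr using fun i => nonempty_subtype.1 (hS i).nonempty
    have rel : ∀ i j k l : Fin 4, i ≠ j → k ≠ l → i ≠ k → i ≠ l → j ≠ k → j ≠ l →
        o (r j) (r l) - o (r j) (r k) - o (r i) (r l) + o (r i) (r k) = 0 := by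
      intro i j k l hij hkl hik hil hjk hjl
      exact turning_connectedOn ho ((hS i).union (hS j) (hadj i j hij))
        ((hS k).union (hS l) (hadj k l hkl))
        (by
          rw [disjoint_union_left, disjoint_union_right, disjoint_union_right]
          exact ⟨⟨hdis _ _ hik, hdis _ _ hil⟩, hdis _ _ hjk, hdis _ _ hjl⟩)
        (Or.inl (hr i)) (Or.inr (hr j)) (Or.inl (hr k)) (Or.inr (hr l))
    have hne : ∀ i j : Fin 4, i ≠ j → r i ≠ r j := fun i j hij h =>
      Set.disjoint_left.1 (hdis i j hij) (hr i) (h ▸ hr j)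
    have r1 := rel 0 1 2 3 (by decide) (by decide) (by decide) (by decide) (by decide) (by decide)
    have r2 := rel 0 2 1 3 (by decide) (by decide) (by decide) (by decide) (by decide) (by decide)
    have r3 := rel 0 3 1 2 (by decide) (by decide) (by decide) (by decide) (by decide) (by decide)
    have a12 := hanti (r 1) (r 2)
    have a13 := hanti (r 1) (r 3)
    have a23 := hanti (r 2) (r 3)
    obtain ⟨x, hx⟩ := hodd _ _ (hne 1 3 (by decide))
    obtain ⟨y, hy⟩ := hodd _ _ (hne 0 3 (by decide))
    obtain ⟨z, hz⟩ := hodd _ _ (hne 0 1 (by decide))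
    -- The sum of the three relations is twice `o₁₃ - o₀₃ + o₀₁`, a sum of three odd numbers.
    omega
  · rintro ⟨S, (hS : ∀ i, G.ConnectedOn (S i)), hdis, hadj⟩
    choose r hr using fun i => nonempty_subtype.1 (hS i).nonempty
    have hne : ∀ i j, i ≠ j → r i ≠ r j := fun i j hij h =>
      Set.disjoint_left.1 (hdis i j hij) (hr i) (h ▸ hr j)
    -- The paths `x - bᵢ` and `y - bⱼ` are disjoint for `i ≠ j`.
    have rel : ∀ i j : Fin 3, i ≠ j →
        o (r (.inr i)) (r (.inr j)) - o (r (.inr i)) (r (.inl 1)) - o (r (.inl 0)) (r (.inr j)) +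
          o (r (.inl 0)) (r (.inl 1)) = 0 := by
      intro i j hij
      exact turning_connectedOn ho
        ((hS (.inl 0)).union (hS (.inr i)) (hadj _ _ (by simp)))
        ((hS (.inl 1)).union (hS (.inr j)) (hadj _ _ (by simp)))
        (by
          rw [disjoint_union_left, disjoint_union_right, disjoint_union_right]
          exact ⟨⟨hdis _ _ (by simp), hdis _ _ (by simp)⟩, hdis _ _ (by simp),
            hdis _ _ (by simpa using hij)⟩)
        (Or.inl (hr _)) (Or.inr (hr _)) (Or.inl (hr _)) (Or.inr (hr _))
    have r01 := rel 0 1 (by decide)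
    have r10 := rel 1 0 (by decide)
    have r02 := rel 0 2 (by decide)
    have r20 := rel 2 0 (by decide)
    have r12 := rel 1 2 (by decide)
    have r21 := rel 2 1 (by decide)
    have a01 := hanti (r (.inr 0)) (r (.inr 1))
    have a02 := hanti (r (.inr 0)) (r (.inr 2))
    have a12 := hanti (r (.inr 1)) (r (.inr 2))
    obtain ⟨x, hx⟩ := hodd _ _ (hne (.inl 0) (.inl 1) (by simp))
    obtain ⟨y, hy⟩ := hodd _ _ (hne (.inl 0) (.inr 0) (by simp))
    obtain ⟨z, hz⟩ := hodd _ _ (hne (.inr 0) (.inl 1) (by simp))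
    -- The even numbers `sᵢ = o x bᵢ + o bᵢ y` satisfy `sᵢ + sⱼ = 2 * o x y` for `i ≠ j`, hence are all
    -- equal to the odd number `o x y`.
    omega

end PlaneDrawing

/-! ### Rooted squares -/

namespace SimpleGraph

variable {V : Type*} {G : SimpleGraph V}

/-- The sets `X, Y` and `Z, W` are the sides of a `K₂,₂` minor of `G` within `A`, and the branch
sets of the first side contain the roots `s` and `t`. -/
structure IsRootedSquare (G : SimpleGraph V) (A : Set V) (s t : V) (X Y Z W : Set V) : Prop where
  subX : X ⊆ A
  subY : Y ⊆ A
  subZ : Z ⊆ A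
  subW : W ⊆ A
  mem_left : s ∈ X
  mem_right : t ∈ Y
  connX : G.ConnectedOn X
  connY : G.ConnectedOn Y
  connZ : G.ConnectedOn Z
  connW : G.ConnectedOn W
  disjXY : Disjoint X Y
  disjXZ : Disjoint X Z
  disjXW : Disjoint X W
  disjYZ : Disjoint Y Z
  disjYW : Disjoint Y W
  disjZW : Disjoint Z W
  linkXZ : G.Linked X Z
  linkXW : G.Linked X W
  linkYZ : G.Linked Y Z
  linkYW : G.Linked Y W

lemma IsRootedSquare.swap {A : Set V} {s t : V} {X Y Z W : Set V}
    (h : G.IsRootedSquare A s t X Y Z W) : G.IsRootedSquare A s t X Y W Z :=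
  ⟨h.subX, h.subY, h.subW, h.subZ, h.mem_left, h.mem_right, h.connX, h.connY, h.connW, h.connZ,
    h.disjXY, h.disjXW, h.disjXZ, h.disjYW, h.disjYZ, h.disjZW.symm, h.linkXW, h.linkXZ,
    h.linkYW, h.linkYZ⟩

/-- There is no rooted square at `s` and `t` within `A`. Together with the exclusion of `K₄` and
`K₂,₃`, this says that `s` and `t` can be made the two end-vertices of a layout of `A`. -/
def NoRootedSquare (G : SimpleGraph V) (A : Set V) (s t : V) : Prop :=
  ∀ X Y Z W, ¬ G.IsRootedSquare A s t X Y Z W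

lemma NoRootedSquare.mono {A B : Set V} {s t : V} (h : G.NoRootedSquare A s t) (hBA : B ⊆ A) :
    G.NoRootedSquare B s t := fun X Y Z W hS => h X Y Z W { hS with
    subX := hS.subX.trans hBA
    subY := hS.subY.trans hBA
    subZ := hS.subZ.trans hBA
    subW := hS.subW.trans hBA }

/-- Three neighbours of a vertex, in disjoint connected sets `Y, Z, W` of which `Y` is linked to
the others: the neighbour in `Y` separates those in `Z` and `W`. The sets `Z` and `W` are enlarged
as far as possible; if they still are not linked, then a part of `Y` is the centre of a claw. -/
lemma OuterplanarMinorFree.false_of_three_neighbors [Finite V] (hG : G.OuterplanarMinorFree)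
    {s t u v : V} (hst : G.Adj s t) (hsu : G.Adj s u) (hsv : G.Adj s v) {Y Z W Q : Set V}
    (hY : G.ConnectedOn Y) (hZ : G.ConnectedOn Z) (hW : G.ConnectedOn W) (hQ : G.ConnectedOn Q)
    (dYZ : Disjoint Y Z) (dYW : Disjoint Y W) (dZW : Disjoint Z W)
    (sY : s ∉ Y) (sZ : s ∉ Z) (sW : s ∉ W) (tY : t ∈ Y) (uZ : u ∈ Z) (vW : v ∈ W)
    (lYZ : G.Linked Y Z) (lYW : G.Linked Y W)
    (sQ : s ∉ Q) (tQ : t ∉ Q) (uQ : u ∈ Q) (vQ : v ∈ Q) : False := by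
  obtain ⟨⟨Y, Z, W⟩, ⟨hY, hZ, hW, dYZ, dYW, dZW, sY, sZ, sW, tY, uZ, vW, lYZ, lYW⟩, hmax⟩ :=
    exists_maximum_of_finite (P := fun p : Set V × Set V × Set V =>
      G.ConnectedOn p.1 ∧ G.ConnectedOn p.2.1 ∧ G.ConnectedOn p.2.2 ∧ Disjoint p.1 p.2.1 ∧
      Disjoint p.1 p.2.2 ∧ Disjoint p.2.1 p.2.2 ∧ s ∉ p.1 ∧ s ∉ p.2.1 ∧ s ∉ p.2.2 ∧
      t ∈ p.1 ∧ u ∈ p.2.1 ∧ v ∈ p.2.2 ∧ G.Linked p.1 p.2.1 ∧ G.Linked p.1 p.2.2)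
    (fun p => p.2.1.ncard + p.2.2.ncard) (a := (Y, Z, W))
    ⟨hY, hZ, hW, dYZ, dYW, dZW, sY, sZ, sW, tY, uZ, vW, lYZ, lYW⟩
  dsimp only at hY hZ hW dYZ dYW dZW sY sZ sW tY uZ vW lYZ lYW hmax
  have hs := connectedOn_singleton (G := G) s
  obtain ⟨z, hz, y, hy, hzZ, hyZ, hzy⟩ :=
    hQ.exists_boundary uQ uZ vQ (fun h => Set.disjoint_left.1 dZW h vW)
  by_cases hyW : y ∈ W
  · exact hG.false_of_k4 hs hY hZ hW (by simpa) (by simpa) (by simpa) dYZ dYW dZW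
      ⟨s, rfl, t, tY, hst⟩ ⟨s, rfl, u, uZ, hsu⟩ ⟨s, rfl, v, vW, hsv⟩ lYZ lYW
      ⟨z, hzZ, y, hyW, hzy⟩
  by_cases hyY : y ∈ Y
  · have hyt : y ≠ t := fun h => tQ (h ▸ hy)
    obtain ⟨T, K, hT, hK, cT, cK, dTK, hTK, lTK⟩ := hY.exists_partition
      (connectedOn_singleton t) (connectedOn_singleton y) (by simpa) (by simpa)
      (by simpa using hyt.symm)
    subst hTK
    rw [disjoint_union_left] at dYZ dYW
    rw [singleton_subset_iff] at hT hK
    rcases lYW.symm.of_union with hWT | hWK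
    · have := hmax (T, Z ∪ K, W) ⟨cT, hZ.union cK ⟨z, hzZ, y, hK, hzy⟩, hW,
        disjoint_union_right.2 ⟨dYZ.1, dTK⟩, dYW.1, disjoint_union_left.2 ⟨dZW, dYW.2⟩,
        fun h => sY (Or.inl h), fun h => h.elim sZ fun h => sY (Or.inr h), sW, hT, Or.inl uZ, vW,
        lTK.mono subset_rfl subset_union_right, hWT.symm⟩
      dsimp only at this
      rw [Set.ncard_union_eq dYZ.2.symm] at this
      have : 0 < K.ncard := (Set.ncard_pos).2 ⟨y, hK⟩
      omega
    · exact hG.false_of_k23 hs cK hZ hW cT (by simp_all) (by simpa) (by simpa) (by simp_all)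
        dYZ.2 dYW.2 dTK.symm dZW dYZ.1.symm dYW.1.symm
        ⟨s, rfl, u, uZ, hsu⟩ ⟨s, rfl, v, vW, hsv⟩ ⟨s, rfl, t, hT, hst⟩
        ⟨y, hK, z, hzZ, hzy.symm⟩ hWK.symm lTK.symm
  · have := hmax (Y, insert y Z, W) ⟨hY, hZ.insert_of_adj hzZ hzy, hW,
      by rw [Set.disjoint_insert_right]; exact ⟨hyY, dYZ⟩, dYW,
      by rw [Set.disjoint_insert_left]; exact ⟨hyW, dZW⟩, sY,
      by rintro (rfl | h); exacts [sQ hy, sZ h], sW, tY, Or.inr uZ, vW,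
      lYZ.mono subset_rfl (subset_insert _ _), lYW⟩
    dsimp only at this
    rw [Set.ncard_insert_of_notMem hyZ] at this
    omega

/-- If the roots `s` and `t` are adjacent, then the branch set of `s` can be shrunk to `{s}`. -/
lemma IsRootedSquare.exists_singleton [Finite V] (hG : G.OuterplanarMinorFree) {A : Set V}
    {s t : V} (hst : G.Adj s t) {X Y Z W : Set V} (h : G.IsRootedSquare A s t X Y Z W) :
    ∃ Z W, G.IsRootedSquare A s t {s} Y Z W := by
  induction hn : X.ncard using Nat.strong_induction_on generalizing X Z W with
  | _ n ih =>
  subst hn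
  by_cases hX : X = {s}
  · subst hX
    exact ⟨Z, W, h⟩
  obtain ⟨x, hx, hxs⟩ : ∃ x ∈ X, x ≠ s := by
    by_contra! hcon
    exact hX (Set.eq_singleton_iff_unique_mem.2 ⟨h.mem_left, hcon⟩)
  obtain ⟨S, K, hS, hK, cS, cK, dSK, hSK, lSK⟩ := h.connX.exists_partition
    (connectedOn_singleton s) (connectedOn_singleton x) (by simpa using h.mem_left) (by simpa)
    (by simpa using hxs.symm)
  subst hSK
  rw [singleton_subset_iff] at hS hK
  have sX := union_subset_iff.1 h.subX
  have dXY := disjoint_union_left.1 h.disjXY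
  have dXZ := disjoint_union_left.1 h.disjXZ
  have dXW := disjoint_union_left.1 h.disjXW
  have hlt : S.ncard < (S ∪ K).ncard := by
    rw [Set.ncard_union_eq dSK]
    have : 0 < K.ncard := (Set.ncard_pos).2 ⟨x, hK⟩
    omega
  -- A branch set linked to `K` but not to `S` absorbs `K`.
  have absorb : ∀ {Z W : Set V}, G.IsRootedSquare A s t (S ∪ K) Y Z W → G.Linked Z K →
      G.Linked W S → ∃ Z W, G.IsRootedSquare A s t {s} Y Z W := by
    intro Z W h hZK hWS
    have dXY := disjoint_union_left.1 h.disjXY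
    have dXZ := disjoint_union_left.1 h.disjXZ
    have dXW := disjoint_union_left.1 h.disjXW
    refine ih _ hlt (X := S) (Z := Z ∪ K) (W := W) ?_ rfl
    exact ⟨sX.1, h.subY, union_subset h.subZ sX.2, h.subW, hS, h.mem_right, cS, h.connY,
      h.connZ.union cK hZK, h.connW, dXY.1,
      disjoint_union_right.2 ⟨dXZ.1, dSK⟩, dXW.1, disjoint_union_right.2 ⟨h.disjYZ, dXY.2.symm⟩,
      h.disjYW, disjoint_union_left.2 ⟨h.disjZW, dXW.2⟩, lSK.mono subset_rfl subset_union_right,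
      hWS.symm, h.linkYZ.mono subset_rfl subset_union_left, h.linkYW⟩
  rcases h.linkXZ.symm.of_union with hZS | hZK <;> rcases h.linkXW.symm.of_union with hWS | hWK
  · refine ih _ hlt (X := S) (Z := Z) (W := W) ?_ rfl
    exact ⟨sX.1, h.subY, h.subZ, h.subW, hS, h.mem_right, cS, h.connY, h.connZ, h.connW,
      dXY.1, dXZ.1, dXW.1,
      h.disjYZ, h.disjYW, h.disjZW, hZS.symm, hWS.symm, h.linkYZ, h.linkYW⟩
  · exact absorb h.swap hWK hZS
  · exact absorb h hZK hWS
  · -- Both `Z` and `W` are linked to `K` only: the sides are `K, Y` and `Z, W, S`.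
    exact (hG.false_of_k23 cK h.connY h.connZ h.connW cS dXY.2 dXZ.2 dXW.2 dSK.symm h.disjYZ
      h.disjYW dXY.1.symm h.disjZW dXZ.1.symm dXW.1.symm hZK.symm hWK.symm lSK.symm h.linkYZ
      h.linkYW ⟨t, h.mem_right, s, hS, hst.symm⟩).elim

/-- Every vertex `s` has a partner `t` such that there is no rooted square at `s` and `t`. A
neighbour `t` of `s` works if a connected set `Q` avoiding `s` and `t`, close to `t` and containing
another neighbour of `s`, is as large as possible. -/
lemma OuterplanarMinorFree.exists_noRootedSquare [Finite V] (hG : G.OuterplanarMinorFree)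
    {A : Set V} {s : V} (hs : s ∈ A) (hA : A ≠ {s}) :
    ∃ t ∈ A, t ≠ s ∧ G.NoRootedSquare A s t := by
  by_cases hU : ∃ t ∈ A, G.Adj s t
  swap
  · push Not at hU
    obtain ⟨t, ht, hts⟩ : ∃ t ∈ A, t ≠ s := by
      by_contra! hcon
      exact hA (Set.eq_singleton_iff_unique_mem.2 ⟨hs, hcon⟩)
    refine ⟨t, ht, hts, fun X Y Z W h => ?_⟩
    have hX : X ⊆ {s} := by
      intro x hx
      by_contra hxs
      obtain ⟨a, -, b, hb, has, -, hab⟩ :=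
        h.connX.exists_boundary (X := {s}) h.mem_left rfl hx hxs
      rw [mem_singleton_iff.1 has] at hab
      exact hU b (h.subX hb) hab
    obtain ⟨a, ha, b, hb, hab⟩ := h.linkXZ
    exact hU b (h.subZ hb) (hX ha ▸ hab)
  by_contra! hcon
  -- Every neighbour `t` of `s` has a rooted square, in which the branch set of `s` is `{s}`.
  have hsq : ∀ t ∈ A, G.Adj s t → ∃ Y Z W, G.IsRootedSquare A s t {s} Y Z W := by
    intro t ht hst
    have := hcon t ht hst.ne'
    simp only [NoRootedSquare, not_forall, not_not] at this
    obtain ⟨X, Y, Z, W, h⟩ := this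
    exact ⟨Y, h.exists_singleton hG hst⟩
  -- The sets `Q` for a neighbour `t`; the set `M` witnesses that `Q` and `t` are connected off `s`.
  let P : V × Set V → Prop := fun p => p.1 ∈ A ∧ G.Adj s p.1 ∧ G.ConnectedOn p.2 ∧ p.1 ∉ p.2 ∧
    s ∉ p.2 ∧ ∃ M, G.ConnectedOn M ∧ p.2 ⊆ M ∧ p.1 ∈ M ∧ s ∉ M
  have hne : ∃ p, P p := by
    obtain ⟨t, ht, hst⟩ := hU
    obtain ⟨Y, Z, W, h⟩ := hsq t ht hst
    refine ⟨(t, Z), ht, hst, h.connZ, Set.disjoint_left.1 h.disjYZ h.mem_right,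
      Set.disjoint_left.1 h.disjXZ rfl, Y ∪ Z, h.connY.union h.connZ h.linkYZ, subset_union_right,
      Or.inl h.mem_right, ?_⟩
    rintro (h' | h')
    · exact Set.disjoint_left.1 h.disjXY rfl h'
    · exact Set.disjoint_left.1 h.disjXZ rfl h'
  obtain ⟨p₀, hp₀⟩ := hne
  obtain ⟨⟨t, Q⟩, ⟨htA, hst, hQ, htQ, hsQ, M, hM, hQM, htM, hsM⟩, hmax⟩ :=
    exists_maximum_of_finite (fun p : V × Set V => p.2.ncard) hp₀
  dsimp only at htA hst hQ htQ hsQ hQM htM hsM hmax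
  have hQt : ∃ q ∈ Q, G.Adj q t := by
    obtain ⟨⟨a, ha⟩⟩ := hQ.nonempty
    obtain ⟨q, hq, m, hm, hqQ, hmQ, hqm⟩ := hM.exists_boundary (hQM ha) ha htM htQ
    by_contra! hcon
    have hmt : m ≠ t := fun h => hcon q hqQ (h ▸ hqm)
    have := hmax (t, insert m Q) ⟨htA, hst, hQ.insert_of_adj hqQ hqm,
      by rintro (h | h); exacts [hmt h.symm, htQ h], by rintro (h | h); exacts [hsM (h ▸ hm), hsQ h],
      M, hM, insert_subset hm hQM, htM, hsM⟩
    dsimp only at this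
    rw [Set.ncard_insert_of_notMem hmQ] at this
    omega
  obtain ⟨q, hq, hqt⟩ := hQt
  -- The neighbours of `s` in a rooted square at `t` lie in `Q`: a neighbour `u` outside `Q` would
  -- have the larger set `Q ∪ {t}`.
  have hmem : ∀ {Y Z W : Set V}, G.IsRootedSquare A s t {s} Y Z W → ∃ u ∈ Z, G.Adj s u ∧ u ∈ Q := by
    intro Y Z W h
    obtain ⟨a, has, u, hu, hsu⟩ := h.linkXZ
    rw [mem_singleton_iff.1 has] at hsu
    refine ⟨u, hu, hsu, ?_⟩
    by_contra huQ
    have hut : u ≠ t := by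
      rintro rfl
      exact Set.disjoint_left.1 h.disjYZ h.mem_right hu
    have hsYZ : s ∉ Y ∪ Z := by
      rintro (h' | h')
      · exact Set.disjoint_left.1 h.disjXY rfl h'
      · exact Set.disjoint_left.1 h.disjXZ rfl h'
    have := hmax (u, insert t Q) ⟨h.subZ hu, hsu, hQ.insert_of_adj hq hqt,
      by rintro (h | h); exacts [hut h, huQ h],
      by rintro (h | h); exacts [hst.ne h, hsQ h],
      insert t Q ∪ (Y ∪ Z), SimpleGraph.induce_union_connected
        (hQ.insert_of_adj hq hqt).preconnected (h.connY.union h.connZ h.linkYZ).preconnected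
        ⟨t, Or.inl rfl, Or.inl h.mem_right⟩, subset_union_left, Or.inr (Or.inr hu),
      by
        rintro ((h | h) | h)
        exacts [hst.ne h, hsQ h, hsYZ h]⟩
    dsimp only at this
    rw [Set.ncard_insert_of_notMem htQ] at this
    omega
  obtain ⟨Y, Z, W, h⟩ := hsq t htA hst
  obtain ⟨u, hu, hsu, huQ⟩ := hmem h
  obtain ⟨v, hv, hsv, hvQ⟩ := hmem h.swap
  exact hG.false_of_three_neighbors hst hsu hsv h.connY h.connZ h.connW hQ h.disjYZ h.disjYW
    h.disjZW (Set.disjoint_left.1 h.disjXY rfl) (Set.disjoint_left.1 h.disjXZ rfl)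
    (Set.disjoint_left.1 h.disjXW rfl) h.mem_right hu hv h.linkYZ h.linkYW hsQ htQ huQ hvQ

end SimpleGraph

/-! ### Layouts on a line -/

namespace SimpleGraph

variable {V : Type*} {G : SimpleGraph V}

/-- `f` places the vertices of `A` on a line in such a way that the edges within `A` can be drawn
on one side of the line without crossings: no two edges have interlacing ends. -/
structure IsLayout (G : SimpleGraph V) (A : Set V) (f : V → ℤ) : Prop where
  injOn : InjOn f A
  not_interlaced : ∀ a ∈ A, ∀ b ∈ A, ∀ c ∈ A, ∀ d ∈ A, f a < f b → f b < f c → f c < f d →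
    G.Adj a c → ¬ G.Adj b d

lemma IsLayout.of_eq_add {A : Set V} {f F : V → ℤ} (h : G.IsLayout A f) {k : ℤ}
    (hF : ∀ x ∈ A, F x = f x + k) : G.IsLayout A F where
  injOn x hx y hy hxy := h.injOn hx hy (by rw [hF x hx, hF y hy] at hxy; omega)
  not_interlaced a ha b hb c hc d hd := by
    rw [hF a ha, hF b hb, hF c hc, hF d hd]
    intro h1 h2 h3
    exact h.not_interlaced a ha b hb c hc d hd (by omega) (by omega) (by omega)

lemma IsLayout.neg {A : Set V} {f : V → ℤ} (h : G.IsLayout A f) :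
    G.IsLayout A (fun x => - f x) where
  injOn x hx y hy hxy := h.injOn hx hy (by simpa using hxy)
  not_interlaced a ha b hb c hc d hd h1 h2 h3 hac hbd :=
    h.not_interlaced d hd c hc b hb a ha (by omega) (by omega) (by omega) hbd.symm hac.symm

/-- A layout of `A` followed by a layout of `B` is a layout, if the only edges from one to the
other join the first vertex to the last one. The sets may share the vertex where they meet. -/
lemma IsLayout.union {A B : Set V} {F : V → ℤ} (hA : G.IsLayout A F) (hB : G.IsLayout B F)
    (hlt : ∀ x ∈ A, ∀ y ∈ B, y ∉ A → F x < F y) (hle : ∀ x ∈ A, ∀ y ∈ B, F x ≤ F y)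
    (hedge : ∀ x ∈ A, x ∉ B → ∀ y ∈ B, y ∉ A → G.Adj x y →
      (∀ z ∈ A, F x ≤ F z) ∧ ∀ z ∈ B, F z ≤ F y) : G.IsLayout (A ∪ B) F where
  injOn x hx y hy hxy := by
    by_cases hxA : x ∈ A <;> by_cases hyA : y ∈ A
    · exact hA.injOn hxA hyA hxy
    · exact absurd hxy (hlt x hxA y (hy.resolve_left hyA) hyA).ne
    · exact absurd hxy (hlt y hyA x (hx.resolve_left hxA) hxA).ne'
    · exact hB.injOn (hx.resolve_left hxA) (hy.resolve_left hyA) hxy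
  not_interlaced a ha b hb c hc d hd hab hbc hcd hac hbd := by
    by_cases hdA : d ∈ A
    · have hin : ∀ x ∈ A ∪ B, F x < F d → x ∈ A := fun x hx hxd => by
        by_contra hxA
        exact absurd (hlt d hdA x (hx.resolve_left hxA) hxA) (by omega)
      exact hA.not_interlaced a (hin a ha (by omega)) b (hin b hb (by omega)) c
        (hin c hc (by omega)) d hdA hab hbc hcd hac hbd
    have hdB := hd.resolve_left hdA
    by_cases haB : a ∈ B
    · have hin : ∀ x ∈ A ∪ B, F a < F x → x ∈ B := fun x hx hxa => by
        by_contra hxB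
        exact absurd (hle x (hx.resolve_right hxB) a haB) (by omega)
      exact hB.not_interlaced a haB b (hin b hb (by omega)) c (hin c hc (by omega)) d
        (hin d hd (by omega)) hab hbc hcd hac hbd
    have haA := ha.resolve_right haB
    by_cases hcA : c ∈ A
    · -- `b` comes before `c`, so the edge `b d` leads from `A` to `B` but is not at the first vertex
      have hbB : b ∉ B := fun hbB => absurd (hle c hcA b hbB) (by omega)
      have := (hedge b (hb.resolve_right hbB) hbB d hdB hdA hbd).1 a haA
      omega
    · have := (hedge a haA haB c (hc.resolve_left hcA) hcA hac).2 d hdB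
      omega

/-- Two placements are put one behind the other by shifting the second one. -/
lemma exists_concat_disjoint [Finite V] {A B : Set V} (hAB : Disjoint A B) (f g : V → ℤ) :
    ∃ (F : V → ℤ) (k : ℤ), (∀ x ∈ A, F x = f x) ∧ (∀ x ∈ B, F x = g x + k) ∧
      ∀ x ∈ A, ∀ y ∈ B, F x < F y := by
  classical
  obtain ⟨M, hM⟩ := (Set.finite_range f).bddAbove
  obtain ⟨m, hm⟩ := (Set.finite_range g).bddBelow
  have hB : ∀ x ∈ B, x ∉ A := fun x hx hx' => Set.disjoint_left.1 hAB hx' hx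
  refine ⟨fun x => if x ∈ A then f x else g x + (M - m + 1), M - m + 1, fun x hx => by simp [hx],
    fun x hx => by simp [hB x hx], fun x hx y hy => ?_⟩
  simp only [hx, if_true, hB y hy, if_false]
  have := hM ⟨x, rfl⟩
  have := hm ⟨y, rfl⟩
  omega

/-- Two placements are put one behind the other so that the last vertex of the first one is the
first vertex of the second one. -/
lemma exists_concat_singleton {A B : Set V} {c : V} {f g : V → ℤ} (hAB : A ∩ B = {c})
    (hf : ∀ x ∈ A, f x ≤ f c) (hg : ∀ x ∈ B, g c ≤ g x) (hgi : InjOn g B) :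
    ∃ (F : V → ℤ) (k : ℤ), (∀ x ∈ A, F x = f x) ∧ (∀ x ∈ B, F x = g x + k) ∧
      (∀ x ∈ A, ∀ y ∈ B, y ∉ A → F x < F y) ∧ ∀ x ∈ A, ∀ y ∈ B, F x ≤ F y := by
  classical
  obtain ⟨hcA, hcB⟩ : c ∈ A ∩ B := by simp [hAB]
  have hF : ∀ x ∈ B, (if x ∈ A then f x else g x + (f c - g c)) = g x + (f c - g c) := by
    intro x hx
    split_ifs with hxA
    · obtain rfl : x = c := by
        have : x ∈ A ∩ B := ⟨hxA, hx⟩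
        rwa [hAB] at this
      omega
    · rfl
  refine ⟨fun x => if x ∈ A then f x else g x + (f c - g c), f c - g c, fun x hx => by simp [hx],
    hF, fun x hx y hy hyA => ?_, fun x hx y hy => ?_⟩
  · simp only [hx, if_true, hyA, if_false]
    have h1 := hf x hx
    have h2 := hg y hy
    have h3 : g c ≠ g y := fun h => hyA (hgi hcB hy h ▸ hcA)
    omega
  · dsimp only
    rw [hF y hy, if_pos hx]
    have h1 := hf x hx
    have h2 := hg y hy
    omega

/-- The inductive step for a layout with prescribed end-vertices `s` and `t`. Grow disjoint
connected sets `X ∋ s` and `Y ∋ t` without edges between them, except possibly `s t`, as far as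
possible. Then each remaining vertex has neighbours in both sets or in none. Two vertices of the
former kind yield a rooted square; if there is one such vertex, then it separates `s` from `t`; if
there is none, then `X` is a component, up to the edge `s t`. -/
lemma exists_layout_of_noRootedSquare [Finite V] {A : Set V}
    (ih : ∀ B : Set V, B.ncard < A.ncard →
      (∀ s ∈ B, ∃ f, G.IsLayout B f ∧ ∀ z ∈ B, f s ≤ f z) ∧
      (∀ s ∈ B, ∀ t ∈ B, s ≠ t → G.NoRootedSquare B s t →
        ∃ f, G.IsLayout B f ∧ (∀ z ∈ B, f s ≤ f z) ∧ ∀ z ∈ B, f z ≤ f t))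
    {s t : V} (hs : s ∈ A) (ht : t ∈ A) (hst : s ≠ t) (hA : G.NoRootedSquare A s t) :
    ∃ f, G.IsLayout A f ∧ (∀ z ∈ A, f s ≤ f z) ∧ ∀ z ∈ A, f z ≤ f t := by
  have hsmall : ∀ {B : Set V} {x : V}, B ⊆ A → x ∈ A → x ∉ B → B.ncard < A.ncard :=
    fun hB hx hxB => Set.ncard_lt_ncard (Set.ssubset_iff_subset_ne.2
      ⟨hB, fun h => hxB (h ▸ hx)⟩)
  obtain ⟨⟨X, Y⟩, ⟨hsX, htY, hX, hY, hXY, hsub, hno⟩, hmax⟩ := exists_maximum_of_finite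
    (P := fun p : Set V × Set V => s ∈ p.1 ∧ t ∈ p.2 ∧ G.ConnectedOn p.1 ∧ G.ConnectedOn p.2 ∧
      Disjoint p.1 p.2 ∧ p.1 ∪ p.2 ⊆ A ∧ ∀ x ∈ p.1, ∀ y ∈ p.2, G.Adj x y → x = s ∧ y = t)
    (fun p => p.1.ncard + p.2.ncard) (a := ({s}, {t}))
    ⟨rfl, rfl, connectedOn_singleton s, connectedOn_singleton t, by simpa using hst,
      by rintro x (rfl | rfl) <;> assumption, fun x hx y hy _ => ⟨hx, hy⟩⟩
  dsimp only at hsX htY hX hY hXY hsub hno hmax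
  have hdis := Set.disjoint_left.1 hXY
  have hXA : X ⊆ A := subset_union_left.trans hsub
  have hYA : Y ⊆ A := subset_union_right.trans hsub
  have hboth : ∀ r ∈ A, r ∉ X → r ∉ Y → (∃ x ∈ X, G.Adj x r) → ∃ y ∈ Y, G.Adj y r := by
    rintro r hr hrX hrY ⟨x, hx, hxr⟩
    by_contra! hcon
    have := hmax (insert r X, Y) ⟨Or.inr hsX, htY, hX.insert_of_adj hx hxr, hY,
      by rw [Set.disjoint_insert_left]; exact ⟨hrY, hXY⟩,
      by rintro z ((rfl | h) | h); exacts [hr, hsub (Or.inl h), hsub (Or.inr h)],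
      by
        rintro a (rfl | ha) y hy hay
        · exact absurd hay.symm (hcon y hy)
        · exact hno a ha y hy hay⟩
    dsimp only at this
    rw [Set.ncard_insert_of_notMem hrX] at this
    omega
  by_cases hc : ∃ c ∈ A, c ∉ X ∧ c ∉ Y ∧ ∃ x ∈ X, G.Adj x c
  · obtain ⟨c, hcA, hcX, hcY, hcx⟩ := hc
    have huniq : ∀ r ∈ A, r ∉ X → r ∉ Y → (∃ x ∈ X, G.Adj x r) → r = c := by
      intro r hr hrX hrY hrx
      by_contra hrc
      obtain ⟨x, hx, hxc⟩ := hcx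
      obtain ⟨x', hx', hxr⟩ := hrx
      obtain ⟨y, hy, hyc⟩ := hboth c hcA hcX hcY ⟨x, hx, hxc⟩
      obtain ⟨y', hy', hyr⟩ := hboth r hr hrX hrY ⟨x', hx', hxr⟩
      exact hA X Y {c} {r} ⟨hXA, hYA, by simpa, by simpa, hsX, htY, hX, hY, connectedOn_singleton c,
        connectedOn_singleton r, hXY, by simpa, by simpa, by simpa, by simpa,
        by simpa using Ne.symm hrc, ⟨x, hx, c, rfl, hxc⟩, ⟨x', hx', r, rfl, hxr⟩,
        ⟨y, hy, c, rfl, hyc⟩, ⟨y', hy', r, rfl, hyr⟩⟩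
    have hsc : s ≠ c := fun h => hcX (h ▸ hsX)
    have htc : t ≠ c := fun h => hcY (h ▸ htY)
    have htX : t ∉ X := fun h => hdis h htY
    have hsub1 : insert c X ⊆ A := insert_subset hcA hXA
    have ht1 : t ∉ insert c X := by rintro (h | h); exacts [htc h, htX h]
    -- A rooted square on one side of the cut vertex `c` becomes one at `s` and `t` when the branch
    -- set of `c` absorbs `Y` or `X`, respectively.
    have sq1 : G.NoRootedSquare (insert c X) s c := by
      intro S T Z W h
      obtain ⟨y, hy, hyc⟩ := hboth c hcA hcX hcY hcx
      have hd : ∀ B : Set V, B ⊆ insert c X → c ∉ B → Disjoint Y B := by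
        intro B hB hcB
        rw [Set.disjoint_left]
        intro z hzY hzB
        rcases hB hzB with rfl | hz
        · exact hcB hzB
        · exact hdis hz hzY
      have cT := h.mem_right
      have dS := hd S h.subX fun hm => Set.disjoint_left.1 h.disjXY hm cT
      have dZ := hd Z h.subZ fun hm => Set.disjoint_left.1 h.disjYZ cT hm
      have dW := hd W h.subW fun hm => Set.disjoint_left.1 h.disjYW cT hm
      exact hA S (T ∪ Y) Z W ⟨h.subX.trans hsub1, union_subset (h.subY.trans hsub1) hYA,
        h.subZ.trans hsub1, h.subW.trans hsub1, h.mem_left, Or.inr htY, h.connX,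
        h.connY.union hY ⟨c, cT, y, hy, hyc.symm⟩, h.connZ, h.connW,
        disjoint_union_right.2 ⟨h.disjXY, dS.symm⟩, h.disjXZ, h.disjXW,
        disjoint_union_left.2 ⟨h.disjYZ, dZ⟩, disjoint_union_left.2 ⟨h.disjYW, dW⟩, h.disjZW,
        h.linkXZ, h.linkXW, h.linkYZ.mono subset_union_left subset_rfl,
        h.linkYW.mono subset_union_left subset_rfl⟩
    have sq2 : G.NoRootedSquare (A \ X) c t := by
      intro S T Z W h
      obtain ⟨x, hx, hxc⟩ := hcx
      have hd : ∀ B : Set V, B ⊆ A \ X → Disjoint X B := by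
        intro B hB
        rw [Set.disjoint_left]
        exact fun z hzX hzB => (hB hzB).2 hzX
      have dT := hd T h.subY
      have dZ := hd Z h.subZ
      have dW := hd W h.subW
      exact hA (S ∪ X) T Z W ⟨union_subset (h.subX.trans sdiff_subset) hXA,
        h.subY.trans sdiff_subset, h.subZ.trans sdiff_subset, h.subW.trans sdiff_subset,
        Or.inr hsX, h.mem_right,
        h.connX.union hX ⟨c, h.mem_left, x, hx, hxc.symm⟩, h.connY, h.connZ, h.connW,
        disjoint_union_left.2 ⟨h.disjXY, dT⟩, disjoint_union_left.2 ⟨h.disjXZ, dZ⟩,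
        disjoint_union_left.2 ⟨h.disjXW, dW⟩, h.disjYZ, h.disjYW, h.disjZW,
        h.linkXZ.mono subset_union_left subset_rfl, h.linkXW.mono subset_union_left subset_rfl,
        h.linkYZ, h.linkYW⟩
    obtain ⟨f, hf, hfs, hfc⟩ := (ih _ (hsmall hsub1 ht ht1)).2 s (Or.inr hsX) c (Or.inl rfl) hsc sq1
    obtain ⟨g, hg, hgc, hgt⟩ := (ih _ (hsmall sdiff_subset hs (fun h => h.2 hsX))).2 c ⟨hcA, hcX⟩ t
      ⟨ht, htX⟩ (Ne.symm htc) sq2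
    have hinter : insert c X ∩ (A \ X) = {c} := by
      ext z
      simp only [mem_inter_iff, mem_insert_iff, Set.mem_sdiff, mem_singleton_iff]
      grind
    have hunion : insert c X ∪ (A \ X) = A := by
      ext z
      simp only [mem_union, mem_insert_iff, Set.mem_sdiff]
      grind
    obtain ⟨F, k, hFf, hFg, hlt, hle⟩ := exists_concat_singleton hinter hfc hgc hg.injOn
    have htA2 : t ∈ A \ X := ⟨ht, htX⟩
    have hfirst : ∀ z ∈ insert c X, F s ≤ F z := fun z hz => by
      rw [hFf s (Or.inr hsX), hFf z hz]; exact hfs z hz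
    have hlast : ∀ z ∈ A \ X, F z ≤ F t := fun z hz => by
      rw [hFg t htA2, hFg z hz]; have := hgt z hz; omega
    have hlay := (hf.of_eq_add (F := F) (k := 0) (by simpa using hFf)).union (hg.of_eq_add hFg)
      hlt hle (by
        intro x hx hx2 y hy hy1 hxy
        have hxX : x ∈ X := by
          by_contra hxX
          exact hx2 ⟨hsub1 hx, hxX⟩
        have hyY : y ∈ Y := by
          by_contra hyY
          exact hy1 (Or.inl (huniq y hy.1 hy.2 hyY ⟨x, hxX, hxy⟩))
        obtain ⟨rfl, rfl⟩ := hno x hxX y hyY hxy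
        exact ⟨hfirst, hlast⟩)
    rw [hunion] at hlay
    refine ⟨F, hlay, fun z hz => ?_, fun z hz => ?_⟩
    · by_cases hzX : z ∈ X
      · exact hfirst z (Or.inr hzX)
      · exact hle s (Or.inr hsX) z ⟨hz, hzX⟩
    · by_cases hzX : z ∈ X
      · exact hle z (Or.inr hzX) t htA2
      · exact hlast z ⟨hz, hzX⟩
  · have htX : t ∉ X := fun h => hdis h htY
    obtain ⟨f, hf, hfs⟩ := (ih X (hsmall hXA ht htX)).1 s hsX
    obtain ⟨g, hg, hgt⟩ := (ih (A \ X) (hsmall sdiff_subset hs (fun h => h.2 hsX))).1 t ⟨ht, htX⟩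
    obtain ⟨F, k, hFf, hFg, hlt⟩ := exists_concat_disjoint
      (Set.disjoint_sdiff_right (s := X) (t := A)) f (fun x => - g x)
    have htA2 : t ∈ A \ X := ⟨ht, htX⟩
    have hfirst : ∀ z ∈ X, F s ≤ F z := fun z hz => by
      rw [hFf s hsX, hFf z hz]; exact hfs z hz
    have hlast : ∀ z ∈ A \ X, F z ≤ F t := fun z hz => by
      rw [hFg t htA2, hFg z hz]; have := hgt z hz; omega
    have hlay := (hf.of_eq_add (F := F) (k := 0) (by simpa using hFf)).union (hg.neg.of_eq_add hFg)
      (fun x hx y hy _ => hlt x hx y hy) (fun x hx y hy => (hlt x hx y hy).le) (by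
        intro x hx hx2 y hy hy1 hxy
        have hyY : y ∈ Y := by
          by_contra hyY
          exact hc ⟨y, hy.1, hy1, hyY, x, hx, hxy⟩
        obtain ⟨rfl, rfl⟩ := hno x hx y hyY hxy
        exact ⟨hfirst, hlast⟩)
    rw [Set.union_sdiff_cancel hXA] at hlay
    refine ⟨F, hlay, fun z hz => ?_, fun z hz => ?_⟩
    · by_cases hzX : z ∈ X
      · exact hfirst z hzX
      · exact (hlt s hsX z ⟨hz, hzX⟩).le
    · by_cases hzX : z ∈ X
      · exact (hlt z hzX t htA2).le
      · exact hlast z ⟨hz, hzX⟩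

/-- A graph without `K₄` and `K₂,₃` minors has a layout with one prescribed end-vertex, and with
two prescribed end-vertices if there is no rooted square at them. -/
lemma OuterplanarMinorFree.exists_layout [Finite V] (hG : G.OuterplanarMinorFree) (A : Set V) :
    (∀ s ∈ A, ∃ f, G.IsLayout A f ∧ ∀ z ∈ A, f s ≤ f z) ∧
      (∀ s ∈ A, ∀ t ∈ A, s ≠ t → G.NoRootedSquare A s t →
        ∃ f, G.IsLayout A f ∧ (∀ z ∈ A, f s ≤ f z) ∧ ∀ z ∈ A, f z ≤ f t) := by
  induction hn : A.ncard using Nat.strong_induction_on generalizing A with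
  | _ n ih =>
  subst hn
  have h2 : ∀ s ∈ A, ∀ t ∈ A, s ≠ t → G.NoRootedSquare A s t →
      ∃ f, G.IsLayout A f ∧ (∀ z ∈ A, f s ≤ f z) ∧ ∀ z ∈ A, f z ≤ f t := fun s hs t ht hst hA =>
    exists_layout_of_noRootedSquare (fun B hB => ih _ hB B rfl) hs ht hst hA
  refine ⟨fun s hs => ?_, h2⟩
  by_cases hA : A = {s}
  · subst hA
    refine ⟨fun _ => 0, ⟨by simp, fun a ha b hb c hc d hd h => absurd h (lt_irrefl _)⟩, by simp⟩
  · obtain ⟨t, ht, hts, hsq⟩ := hG.exists_noRootedSquare hs hA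
    obtain ⟨f, hf, hfs, -⟩ := h2 s hs t ht hts.symm hsq
    exact ⟨f, hf, hfs⟩

/-- If each vertex of the list `L` separates its predecessors in `L` from its successors, and no
two vertices of `L` are the roots of a rooted square, then there is a layout which respects the
order of `L`, has its first and last vertex as end-vertices, and no edge of which passes over a
vertex of `L`. -/
lemma OuterplanarMinorFree.exists_layout_of_list [Finite V] (hG : G.OuterplanarMinorFree)
    (L : List V) (A : Set V) (hLA : ∀ u ∈ L, u ∈ A) (hL : L.Nodup)
    (hsq : ∀ a ∈ L, ∀ b ∈ L, a ≠ b → G.NoRootedSquare A a b)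
    (hsep : ∀ a b c, [a, b, c].Sublist L → ∀ Q, G.ConnectedOn Q → a ∈ Q → c ∈ Q → b ∈ Q) :
    ∃ f, G.IsLayout A f ∧ L.Pairwise (fun a b => f a < f b) ∧
      (∀ u ∈ L.head?, ∀ z ∈ A, f u ≤ f z) ∧
      (2 ≤ L.length → ∀ u ∈ L.getLast?, ∀ z ∈ A, f z ≤ f u) ∧
      ∀ u ∈ L, ∀ a ∈ A, ∀ b ∈ A, G.Adj a b → f a < f u → f b ≤ f u := by
  induction L generalizing A with
  | nil =>
    rcases A.eq_empty_or_nonempty with rfl | ⟨s, hs⟩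
    · exact ⟨fun _ => 0, ⟨by simp, by simp⟩, by simp⟩
    · obtain ⟨f, hf, -⟩ := (hG.exists_layout A).1 s hs
      exact ⟨f, hf, by simp⟩
  | cons u L ih =>
  cases L with
  | nil =>
    obtain ⟨f, hf, hfu⟩ := (hG.exists_layout A).1 u (hLA u (by simp))
    refine ⟨f, hf, by simp, by simpa using hfu, by simp, ?_⟩
    simp only [List.mem_singleton, forall_eq]
    intro a ha b hb hab hlt
    have := hfu a ha
    omega
  | cons v L =>
  have huv : u ≠ v := by
    rintro rfl
    simp at hL
  have huA : u ∈ A := hLA u (by simp)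
  have hvA : v ∈ A := hLA v (by simp)
  have huvsq := hsq u (by simp) v (by simp) huv
  cases L with
  | nil =>
    obtain ⟨f, hf, hfu, hfv⟩ := (hG.exists_layout A).2 u huA v hvA huv huvsq
    refine ⟨f, hf, ?_, by simpa using hfu, by simpa using hfv, ?_⟩
    · simp only [List.pairwise_cons, List.mem_singleton, forall_eq, List.not_mem_nil,
        IsEmpty.forall_iff, implies_true, List.Pairwise.nil, and_self, and_true]
      exact lt_of_le_of_ne (hfu v hvA) fun h => huv (hf.injOn huA hvA h)
    · intro w hw a ha b hb hab hlt
      simp only [List.mem_cons, List.not_mem_nil, or_false] at hw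
      rcases hw with rfl | rfl
      · have := hfu a ha
        omega
      · exact hfv b hb
  | cons w L =>
  -- Split at `v`: `X` is the component of `u` in `A \ {v}`.
  obtain ⟨X, ⟨huX, hX, hXA, hvX⟩, hmax⟩ := exists_maximum_of_finite
    (P := fun X : Set V => u ∈ X ∧ G.ConnectedOn X ∧ X ⊆ A ∧ v ∉ X) Set.ncard (a := {u})
    ⟨rfl, connectedOn_singleton u, by simpa, by simpa using huv.symm⟩
  have hnb : ∀ x ∈ X, ∀ y ∈ A, y ∉ X → G.Adj x y → y = v := by
    intro x hx y hy hyX hxy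
    by_contra hyv
    have := hmax (insert y X) ⟨Or.inr huX, hX.insert_of_adj hx hxy, insert_subset hy hXA,
      by rintro (h | h); exacts [hyv h.symm, hvX h]⟩
    rw [Set.ncard_insert_of_notMem hyX] at this
    omega
  have hsubA : insert v X ⊆ A := insert_subset hvA hXA
  obtain ⟨f, hf, hfu, hfv⟩ := (hG.exists_layout (insert v X)).2 u (Or.inr huX) v (Or.inl rfl) huv
    (huvsq.mono hsubA)
  have hrest : ∀ z ∈ v :: w :: L, z ∈ A \ X := by
    intro z hz
    refine ⟨hLA z (List.mem_cons_of_mem _ hz), fun hzX => ?_⟩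
    rcases List.mem_cons.1 hz with rfl | hz
    · exact hvX hzX
    · refine hvX (hsep u v z ?_ X hX huX hzX)
      exact ((List.singleton_sublist.2 hz).cons_cons _).cons_cons _
  obtain ⟨g, hg, hgL, hgv, hgl, hgo⟩ := ih (A \ X) hrest hL.of_cons
    (fun a ha b hb hab => (hsq a (List.mem_cons_of_mem _ ha) b (List.mem_cons_of_mem _ hb) hab).mono
      sdiff_subset) (fun a b c h => hsep a b c (h.cons _))
  simp only [List.head?_cons, Option.mem_def, Option.some.injEq, forall_eq'] at hgv
  have hinter : insert v X ∩ (A \ X) = {v} := by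
    ext z
    simp only [mem_inter_iff, mem_insert_iff, Set.mem_sdiff, mem_singleton_iff]
    grind
  have hunion : insert v X ∪ (A \ X) = A := by
    ext z
    simp only [mem_union, mem_insert_iff, Set.mem_sdiff]
    grind
  obtain ⟨F, k, hFf, hFg, hlt, hle⟩ := exists_concat_singleton hinter hfv hgv hg.injOn
  have huF : u ∈ insert v X := Or.inr huX
  have hcases : ∀ z ∈ A, z ∈ X ∨ z ∈ A \ X := fun z hz => by
    by_cases h : z ∈ X
    exacts [Or.inl h, Or.inr ⟨hz, h⟩]
  have hlay := (hf.of_eq_add (F := F) (k := 0) (by simpa using hFf)).union (hg.of_eq_add hFg)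
    hlt hle (by
      intro x hx hx2 y hy hy1 hxy
      have hxX : x ∈ X := by
        by_contra hxX
        exact hx2 ⟨hsubA hx, hxX⟩
      exact absurd (Or.inl (hnb x hxX y hy.1 hy.2 hxy)) hy1)
  rw [hunion] at hlay
  have hfirst : ∀ z ∈ A, F u ≤ F z := by
    intro z hz
    rcases hcases z hz with hz | hz
    · rw [hFf u huF, hFf z (Or.inr hz)]; exact hfu z (Or.inr hz)
    · exact hle u huF z hz
  refine ⟨F, hlay, ?_, by simpa using hfirst, ?_, ?_⟩
  · rw [List.pairwise_cons]
    refine ⟨fun z hz => ?_, hgL.imp_of_mem fun {a b} ha hb h => ?_⟩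
    · refine lt_of_le_of_ne (hfirst z (hrest z hz).1) fun h => ?_
      have := hlay.injOn huA (hrest z hz).1 h
      exact (List.nodup_cons.1 hL).1 (this ▸ hz)
    · rw [hFg a (hrest a ha), hFg b (hrest b hb)]; omega
  · intro _ z hz y hy
    have hz' : z ∈ (v :: w :: L).getLast? := by simpa using hz
    have hzA := hrest z (List.mem_of_getLast? hz')
    rcases hcases y hy with hy | hy
    · exact hle y (Or.inr hy) z hzA
    · have := hgl (by simp) z hz' y hy
      rw [hFg y hy, hFg z hzA]; omega
  · intro z hz a ha b hb hab hlt'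
    rcases List.mem_cons.1 hz with rfl | hz
    · have := hfirst a ha
      omega
    have hzA := hrest z hz
    by_cases hb1 : b ∈ insert v X
    · exact hle b hb1 z hzA
    have hb2 : b ∈ A \ X := ⟨hb, fun h => hb1 (Or.inr h)⟩
    rcases hcases a ha with ha | ha
    · exact absurd (Or.inl (hnb a ha b hb hb2.2 hab)) hb1
    · rw [hFg a ha, hFg z hzA] at hlt'
      have := hgo z hz a ha b hb2 hab (by omega)
      rw [hFg b hb2, hFg z hzA]; omega

end SimpleGraph

/-! ### Drawings from layouts -/

/-- A point outside `W` lies on the boundary of the unbounded part of `W` if it is approached by an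
unbounded connected subset of `W`. -/
lemma mem_frontier_unboundedPart {W S : Set ℂ} {z : ℂ} (hS : IsPreconnected S) (hSW : S ⊆ W)
    (hSb : ¬ Bornology.IsBounded S) (hz : z ∈ closure S) (hzW : z ∉ W) :
    z ∈ frontier (unboundedPart W) := by
  have hsub : S ⊆ unboundedPart W := fun w hw =>
    ⟨hSW hw, fun hb => hSb (hb.subset (hS.subset_connectedComponentIn hw hSW))⟩
  exact ⟨closure_mono hsub hz, fun hi => hzW (interior_subset hi).1⟩

/-- The parabola arc over the interval from `p` to `q`, given by `y = (x - p) (q - x)`. -/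
noncomputable def parabolaArc (p q : ℝ) : C(unitInterval, ℂ) where
  toFun t := ((p + (q - p) * t : ℝ) : ℂ) + (((q - p) ^ 2 * t * (1 - t) : ℝ) : ℂ) * Complex.I
  continuous_toFun := by fun_prop

lemma parabolaArc_re (p q : ℝ) (t : unitInterval) :
    (parabolaArc p q t).re = p + (q - p) * t := by
  simp only [parabolaArc, ContinuousMap.coe_mk, Complex.add_re, Complex.ofReal_re,
    Complex.re_ofReal_mul, Complex.I_re, mul_zero, add_zero]

lemma parabolaArc_im (p q : ℝ) (t : unitInterval) :
    (parabolaArc p q t).im = (q - p) ^ 2 * t * (1 - t) := by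
  simp only [parabolaArc, ContinuousMap.coe_mk, Complex.add_im, Complex.ofReal_im,
    Complex.im_ofReal_mul, Complex.I_im, mul_one, zero_add]

lemma parabolaArc_im_eq (p q : ℝ) (t : unitInterval) : (parabolaArc p q t).im =
    ((parabolaArc p q t).re - p) * (q - (parabolaArc p q t).re) := by
  rw [parabolaArc_re, parabolaArc_im]; ring

lemma parabolaArc_im_pos {p q : ℝ} (h : p < q) {t : unitInterval}
    (ht : t ∈ Ioo (0 : unitInterval) 1) : 0 < (parabolaArc p q t).im := by
  have h0 : (0 : ℝ) < t := ht.1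
  have h1 : (t : ℝ) < 1 := ht.2
  rw [parabolaArc_im]
  have : 0 < q - p := sub_pos.2 h
  have : 0 < 1 - (t : ℝ) := sub_pos.2 h1
  positivity

lemma re_parabolaArc_mem_Ioo {p q : ℝ} (h : p < q) {t : unitInterval}
    (ht : 0 < (parabolaArc p q t).im) : (parabolaArc p q t).re ∈ Ioo p q := by
  rw [parabolaArc_im_eq] at ht
  rcases pos_and_pos_or_neg_and_neg_of_mul_pos ht with ⟨h1, h2⟩ | ⟨h1, h2⟩
  · exact ⟨by linarith, by linarith⟩
  · linarith

/-- Two parabola arcs whose intervals do not interlace do not cross: the arc over the larger of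
two nested intervals is strictly higher. -/
lemma eq_of_parabola_eq {p q p' q' x : ℝ} (hx : x ∈ Ioo p q) (hx' : x ∈ Ioo p' q')
    (h : (x - p) * (q - x) = (x - p') * (q' - x)) (h1 : ¬ (p < p' ∧ q < q'))
    (h2 : ¬ (p' < p ∧ q' < q)) : p = p' ∧ q = q' := by
  obtain ⟨a1, a2⟩ := hx
  obtain ⟨b1, b2⟩ := hx'
  rcases lt_trichotomy p p' with hp | rfl | hp
  · have hq : q' ≤ q := not_lt.1 fun hq => h1 ⟨hp, hq⟩
    have : (x - p') * (q' - x) < (x - p) * (q - x) :=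
      mul_lt_mul (by linarith) (by linarith) (by linarith) (by linarith)
    exact absurd h this.ne'
  · refine ⟨rfl, ?_⟩
    have := mul_left_cancel₀ (sub_pos.2 a1).ne' h
    linarith
  · have hq : q ≤ q' := not_lt.1 fun hq => h2 ⟨hp, hq⟩
    have : (x - p) * (q - x) < (x - p') * (q' - x) :=
      mul_lt_mul (by linarith) (by linarith) (by linarith) (by linarith)
    exact absurd h this.ne

namespace SimpleGraph

variable {V : Type*} {G : SimpleGraph V}

/-- A layout of all vertices is turned into a wing-1 drawing by drawing each edge as a parabola
arc. Beside the positions of the vertices, the existential records that an edge runs above its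
interval only. -/
lemma IsLayout.exists_drawing {f : V → ℤ} (hf : G.IsLayout univ f) :
    ∃ D : PlaneDrawing G, D.IsWing1 ∧ (∀ v, D.pos v = (f v : ℝ)) ∧
      ∀ e t, 0 < (D.curve e t).im →
        ∃ a b, G.Adj a b ∧ (f a : ℝ) < (D.curve e t).re ∧ (D.curve e t).re < f b := by
  have hinj : Function.Injective f := Set.injOn_univ.1 hf.injOn
  have hor : ∀ e : G.edgeSet, ∃ a b, (e : Sym2 V) = s(a, b) ∧ G.Adj a b ∧ f a < f b := by
    rintro ⟨e, he⟩
    induction e with | _ a b =>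
    rcases lt_trichotomy (f a) (f b) with h | h | h
    · exact ⟨a, b, rfl, he, h⟩
    · exact absurd (hinj h) (G.ne_of_adj he)
    · exact ⟨b, a, Sym2.eq_swap, G.adj_symm he, h⟩
  choose a b hab hadj hlt using hor
  have hltR : ∀ e, (f (a e) : ℝ) < f (b e) := fun e => by exact_mod_cast hlt e
  have hposI : ∀ {e : G.edgeSet} {t : unitInterval}, t ∈ Ioo (0 : unitInterval) 1 →
      0 < (parabolaArc (f (a e)) (f (b e)) t).im := fun ht => parabolaArc_im_pos (hltR _) ht
  refine ⟨⟨fun v => ((f v : ℝ) : ℂ), fun e => parabolaArc (f (a e)) (f (b e)), ?_, ?_, ?_, ?_, ?_⟩,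
    ⟨fun v => Complex.ofReal_im _, fun e t ht => hposI ht⟩, fun v => rfl, fun e t ht => ?_⟩
  · intro v w h
    have h : ((f v : ℝ) : ℂ) = ((f w : ℝ) : ℂ) := h
    exact hinj (by exact_mod_cast h)
  · intro e s t h
    have h := congrArg Complex.re h
    rw [parabolaArc_re, parabolaArc_re] at h
    have := mul_left_cancel₀ (sub_pos.2 (hltR e)).ne' (add_left_cancel h)
    exact Subtype.ext this
  · intro e
    rw [hab e]
    simp [parabolaArc]
  · intro e t ht v h
    have := hposI (e := e) ht
    rw [h] at this
    simp at this
  · intro e e' hee t ht s h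
    have hp := hposI (e := e) ht
    have hx := re_parabolaArc_mem_Ioo (hltR e) hp
    have him := parabolaArc_im_eq (f (a e)) (f (b e)) t
    have him' := parabolaArc_im_eq (f (a e')) (f (b e')) s
    rw [h] at hp hx him
    have hx' := re_parabolaArc_mem_Ioo (hltR e') hp
    have hni : ∀ e e' : G.edgeSet, ∀ x : ℝ, x ∈ Ioo (f (a e) : ℝ) (f (b e)) →
        x ∈ Ioo (f (a e') : ℝ) (f (b e')) →
        ¬ ((f (a e) : ℝ) < f (a e') ∧ (f (b e) : ℝ) < f (b e')) := by
      rintro e e' x hx hx' ⟨h1, h2⟩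
      have h3 := hx'.1.trans hx.2
      exact hf.not_interlaced _ trivial _ trivial _ trivial _ trivial (by exact_mod_cast h1)
        (by exact_mod_cast h3) (by exact_mod_cast h2) (hadj e) (hadj e')
    obtain ⟨h1, h2⟩ := eq_of_parabola_eq hx hx' (him.symm.trans him') (hni e e' _ hx hx')
      (hni e' e _ hx' hx)
    refine hee (Subtype.ext ?_)
    have ha : a e = a e' := hinj (by exact_mod_cast h1)
    have hb : b e = b e' := hinj (by exact_mod_cast h2)
    rw [hab e, hab e', ha, hb]
  · have := re_parabolaArc_mem_Ioo (hltR e) ht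
    exact ⟨_, _, hadj e, this.1, this.2⟩

end SimpleGraph

namespace PlaneDrawing

variable {V : Type*} {G : SimpleGraph V} {D : PlaneDrawing G}

lemma IsWing1.im_nonneg (hD : D.IsWing1) {z : ℂ} (hz : z ∈ D.support) : 0 ≤ z.im := by
  rcases hz with ⟨v, rfl⟩ | hz
  · exact (hD.1 v).ge
  · obtain ⟨e, t, rfl⟩ := mem_iUnion.1 hz
    rcases D.curve_mem_cases e t with ht | ⟨v, -, hv⟩
    · exact (hD.2 e t ht).le
    · rw [hv]; exact (hD.1 v).ge

/-- A wing-1 drawing leaves the other side of the line free, so all vertices are on the outer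
face. -/
lemma IsWing1.isOuterplanar (hD : D.IsWing1) : D.IsOuterplanar := by
  intro v
  refine mem_frontier_unboundedPart (S := {z : ℂ | z.im < 0})
    (convex_halfSpace_im_lt 0).isPreconnected
    (fun z hz hz' => absurd (hD.im_nonneg hz') (not_le.2 hz)) ?_ ?_ fun h => h (Or.inl ⟨v, rfl⟩)
  · intro hb
    obtain ⟨R, hR⟩ := hb.exists_norm_le
    have h1 := hR (-((|R| + 1 : ℝ) : ℂ) * Complex.I) (by
      simp only [mem_ofPred_eq, neg_mul, Complex.neg_im, Complex.im_ofReal_mul, Complex.I_im, mul_one]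
      have := abs_nonneg R
      linarith)
    rw [neg_mul, norm_neg, norm_mul, Complex.norm_I, mul_one, Complex.norm_real, Real.norm_eq_abs,
      abs_of_nonneg (by positivity)] at h1
    linarith [le_abs_self R]
  · rw [Complex.closure_setOfPred_im_lt]
    exact (hD.1 v).le

/-- A vertex is exposed if no edge passes over it, as then the vertical ray above it is free. -/
lemma isOuterVertex_of_not_covered {v : V} (hv : (D.pos v).im = 0)
    (hD : ∀ w, (D.pos w).im = 0)
    (h : ∀ e t, 0 < (D.curve e t).im → (D.curve e t).re ≠ (D.pos v).re) : D.IsOuterVertex v := by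
  refine mem_frontier_unboundedPart (S := {z : ℂ | z.re = (D.pos v).re} ∩ {z : ℂ | 0 < z.im})
    ((Convex.inter ?_ (convex_halfSpace_im_gt 0)).isPreconnected) ?_ ?_ ?_ ?_
  · exact convex_hyperplane Complex.reLm.isLinear _
  · rintro z ⟨hz1, hz2⟩
    refine ⟨hz2, ?_⟩
    rintro (⟨w, rfl⟩ | hz)
    · exact absurd (hD w) (ne_of_gt hz2)
    · obtain ⟨e, t, rfl⟩ := mem_iUnion.1 hz
      exact h e t hz2 hz1
  · intro hb
    obtain ⟨R, hR⟩ := hb.exists_norm_le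
    have h1 := hR ⟨(D.pos v).re, |R| + 1⟩ ⟨rfl, by change 0 < |R| + 1; positivity⟩
    have h2 := (Complex.abs_im_le_norm _).trans h1
    simp only at h2
    rw [abs_of_nonneg (by positivity)] at h2
    linarith [le_abs_self R]
  · rw [Metric.mem_closure_iff]
    intro ε hε
    refine ⟨⟨(D.pos v).re, ε / 2⟩, ⟨rfl, by change 0 < ε / 2; positivity⟩, ?_⟩
    rw [Complex.dist_of_re_eq (z := D.pos v) (w := ⟨(D.pos v).re, ε / 2⟩) rfl, hv, Real.dist_eq,
      zero_sub, abs_neg, abs_of_pos (by positivity)]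
    linarith
  · exact fun hz => absurd hv (ne_of_gt hz.1)

end PlaneDrawing

/-! ### Perimeter traces -/

section PerimeterTrace

open SimpleGraph

variable {V : Type*} {G : SimpleGraph V}

lemma IsPerimeterTrace.noRootedSquare {U : Set V} (hU : IsPerimeterTrace G U) {a b : V}
    (ha : a ∈ U) (hb : b ∈ U) (A : Set V) : G.NoRootedSquare A a b := by
  intro X Y Z W h
  refine hU.2 ⟨Sum.elim ![X, Y] ![Z, W], ⟨?_, ?_, ?_⟩, Or.inl ?_⟩
  · rintro (i | i) <;> fin_cases i
    exacts [h.connX, h.connY, h.connZ, h.connW]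
  · rintro (i | i) (j | j) hij <;> fin_cases i <;> fin_cases j
    exacts [absurd rfl hij, h.disjXY, h.disjXY.symm, absurd rfl hij, h.disjXZ, h.disjXW, h.disjYZ,
      h.disjYW, h.disjXZ.symm, h.disjYZ.symm, h.disjXW.symm, h.disjYW.symm, absurd rfl hij,
      h.disjZW, h.disjZW.symm, absurd rfl hij]
  · rintro (i | i) (j | j) hij
    · simp [completeBipartiteGraph] at hij
    · fin_cases i <;> fin_cases j
      exacts [h.linkXZ, h.linkXW, h.linkYZ, h.linkYW]
    · fin_cases i <;> fin_cases j
      exacts [h.linkXZ.symm, h.linkYZ.symm, h.linkXW.symm, h.linkYW.symm]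
    · simp [completeBipartiteGraph] at hij
  · intro i
    fin_cases i
    exacts [⟨a, h.mem_left, ha⟩, ⟨b, h.mem_right, hb⟩]

lemma IsPerimeterTrace.false_of_triangle {U : Set V} (hU : IsPerimeterTrace G U)
    {X Y Z : Set V} {a b c : V} (ha : a ∈ U) (hb : b ∈ U) (hc : c ∈ U) (aX : a ∈ X) (bY : b ∈ Y)
    (cZ : c ∈ Z) (hX : G.ConnectedOn X) (hY : G.ConnectedOn Y) (hZ : G.ConnectedOn Z)
    (dXY : Disjoint X Y) (dXZ : Disjoint X Z) (dYZ : Disjoint Y Z) (lXY : G.Linked X Y)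
    (lXZ : G.Linked X Z) (lYZ : G.Linked Y Z) : False := by
  refine hU.1 ⟨![X, Y, Z], ⟨?_, ?_, ?_⟩, ?_⟩
  · intro i
    fin_cases i <;> assumption
  · intro i j hij
    fin_cases i <;> fin_cases j <;>
      first | exact absurd rfl hij | assumption | (apply Disjoint.symm; assumption)
  · intro i j hij
    have hij := hij.ne
    fin_cases i <;> fin_cases j <;>
      first | exact absurd rfl hij | assumption | (apply Linked.symm; assumption)
  · intro i
    fin_cases i
    exacts [⟨a, aX, ha⟩, ⟨b, bY, hb⟩, ⟨c, cZ, hc⟩]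

/-- The part of a path behind its first vertex. -/
lemma SimpleGraph.Walk.IsPath.exists_connectedOn_tail {a b u : V} {p : G.Walk b u} (hp : p.IsPath)
    (ha : a ∈ p.support) (hab : a ≠ b) : ∃ X, G.ConnectedOn X ∧ a ∈ X ∧ b ∉ X ∧
      G.Linked {b} X ∧ ∀ x ∈ X, x ∈ p.support := by
  cases p with
  | nil => exact absurd (by simpa using ha) hab
  | @cons _ m _ h q =>
    refine ⟨{v | v ∈ q.support}, q.connected_induce_support, by simpa [hab] using ha,
      ((Walk.cons_isPath_iff h q).1 hp).2, ⟨b, rfl, m, q.start_mem_support, h⟩, fun x hx => ?_⟩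
    rw [Walk.support_cons]
    exact List.mem_cons_of_mem _ hx

lemma List.mem_of_triple_sublist_split {α : Type*} {a b c : α} {s t : List α}
    (hnd : (s ++ b :: t).Nodup) (h : [a, b, c].Sublist (s ++ b :: t)) : a ∈ s ∧ c ∈ t := by
  rw [List.sublist_append_iff] at h
  obtain ⟨l₁, l₂, heq, h₁, h₂⟩ := h
  have hs : b ∉ s := fun hb => (List.disjoint_of_nodup_append hnd) hb (by simp)
  have ht : b ∉ t := (List.nodup_cons.1 hnd.of_append_right).1
  rcases l₁ with _ | ⟨x, _ | ⟨y, l₁⟩⟩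
  · rw [List.nil_append] at heq
    subst heq
    cases h₂ with
    | cons _ h => exact absurd (h.subset (by simp)) ht
    | cons_cons _ h => exact absurd (h.subset (by simp)) ht
  · obtain ⟨rfl, rfl⟩ := List.cons.inj heq
    refine ⟨h₁.subset (by simp), ?_⟩
    cases h₂ with
    | cons _ h => exact absurd (h.subset (by simp)) ht
    | cons_cons _ h => exact h.subset (by simp)
  · simp only [List.cons_append, List.cons.injEq] at heq
    obtain ⟨-, rfl, -⟩ := heq
    exact absurd (h₁.subset (by simp)) hs

/-- If only entries of the same list in `Ls` are related, then a triple with related ends that occurs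
in the concatenation occurs within one of the lists. -/
lemma List.exists_mem_sublist_of_sublist_flatten {α : Type*} {r : α → α → Prop} {Ls : List (List α)}
    (hLs : Ls.Pairwise fun l l' => ∀ x ∈ l, ∀ y ∈ l', ¬ r x y) {a b c : α} (hac : r a c)
    (h : [a, b, c].Sublist Ls.flatten) : ∃ l ∈ Ls, [a, b, c].Sublist l := by
  induction Ls with
  | nil => simp at h
  | cons l Ls ih =>
    rw [List.flatten_cons, List.sublist_append_iff] at h
    obtain ⟨l₁, l₂, heq, h₁, h₂⟩ := h
    rw [List.pairwise_cons] at hLs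
    have hfar : a ∈ l → c ∈ Ls.flatten → False := fun ha hc => by
      obtain ⟨l', hl', hcl⟩ := List.mem_flatten.1 hc
      exact hLs.1 l' hl' a ha c hcl hac
    rcases l₁ with _ | ⟨x, l₁⟩
    · obtain ⟨l', hl', h'⟩ := ih hLs.2 (by simpa [heq] using h₂)
      exact ⟨l', List.mem_cons_of_mem _ hl', h'⟩
    obtain ⟨rfl, heq⟩ := List.cons.inj heq
    rcases l₂.eq_nil_or_concat with rfl | ⟨l₂', y, rfl⟩
    · refine ⟨l, by simp, ?_⟩
      rw [List.append_nil] at heq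
      rwa [heq]
    · have hy : y = c := by
        have := congrArg List.getLast? heq
        rw [List.concat_eq_append, ← List.append_assoc, List.getLast?_append] at this
        simpa using this.symm
      exact (hfar (h₁.subset (by simp)) (h₂.subset (by simp [hy]))).elim

lemma AppearsInOrder.nodup {L : List V} (hL : AppearsInOrder G L) : L.Nodup := by
  obtain ⟨Ls, rfl, hpath, hreach⟩ := hL
  rw [List.nodup_flatten]
  refine ⟨fun l hl => ?_, hreach.imp fun {l l'} h => ?_⟩
  · obtain ⟨a, b, p, hp, hs⟩ := hpath l hl
    exact hp.support_nodup.sublist hs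
  · exact fun x hx hx' => h x hx x hx' (Reachable.refl x)

/-- In a perimeter trace listed in order, each vertex separates the earlier from the later ones:
otherwise the two parts of the path through it extend to disjoint linked sets, which form a
triangle with it. -/
lemma IsPerimeterTrace.mem_of_sublist [Finite V] {L : List V}
    (hU : IsPerimeterTrace G {v | v ∈ L}) (hL : AppearsInOrder G L) {a b c : V}
    (habc : [a, b, c].Sublist L) {Q : Set V} (hQ : G.ConnectedOn Q) (haQ : a ∈ Q) (hcQ : c ∈ Q) :
    b ∈ Q := by
  classical
  by_contra hbQ
  have hnodup := habc.nodup hL.nodup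
  obtain ⟨Ls, rfl, hpath, hreach⟩ := hL
  have hac : G.Reachable a c :=
    (hQ.preconnected ⟨a, haQ⟩ ⟨c, hcQ⟩).map (Embedding.induce Q).toHom
  obtain ⟨l, hl, hs⟩ := List.exists_mem_sublist_of_sublist_flatten hreach hac habc
  obtain ⟨u, v, p, hp, hlp⟩ := hpath l hl
  have hsub := hs.trans hlp
  have hbp : b ∈ p.support := hsub.subset (by simp)
  have hab : a ≠ b := by rintro rfl; simp at hnodup
  have hcb : c ≠ b := by rintro rfl; simp at hnodup
  set p₁ := p.takeUntil b hbp
  set p₂ := p.dropUntil b hbp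
  have hspec : p₁.append p₂ = p := p.take_spec hbp
  have hsupp : p.support = p₁.support.dropLast ++ b :: p₂.support.tail := by
    rw [← hspec, Walk.support_append_eq_support_dropLast_append, Walk.cons_tail_support]
  rw [hsupp] at hsub
  obtain ⟨ha, hc⟩ := List.mem_of_triple_sublist_split (hsupp ▸ hp.support_nodup) hsub
  have hdis : ∀ x, x ∈ p₁.support → x ∈ p₂.support → x = b := by
    intro x hx hx'
    have hnd := hp.support_nodup
    rw [← hspec, Walk.support_append] at hnd
    rw [← Walk.cons_tail_support] at hx'
    rcases List.mem_cons.1 hx' with rfl | hx'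
    · rfl
    · exact absurd hx' (List.disjoint_of_nodup_append hnd hx)
  obtain ⟨X, hX, haX, hbX, lX, hXp⟩ := (hp.takeUntil hbp).reverse.exists_connectedOn_tail
    (a := a) (by rw [Walk.support_reverse, List.mem_reverse]; exact List.mem_of_mem_dropLast ha) hab
  obtain ⟨Z, hZ, hcZ, hbZ, lZ, hZp⟩ := (hp.dropUntil hbp).exists_connectedOn_tail
    (a := c) (List.mem_of_mem_tail hc) hcb
  have hXZ : Disjoint X Z := by
    rw [Set.disjoint_left]
    intro x hx hx'
    have h1 := hXp x hx
    rw [Walk.support_reverse, List.mem_reverse] at h1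
    exact hbX (hdis x h1 (hZp x hx') ▸ hx)
  have hC : G.ConnectedOn (Q ∪ X ∪ Z) :=
    induce_union_connected (induce_union_connected hQ.preconnected hX.preconnected
      ⟨a, haQ, haX⟩).preconnected hZ.preconnected ⟨c, Or.inl hcQ, hcZ⟩
  obtain ⟨X', Z', hXX', hZZ', cX', cZ', dXZ', hun, lXZ'⟩ := hC.exists_partition hX hZ
    (subset_union_right.trans subset_union_left) subset_union_right hXZ
  have hb : b ∉ X' ∪ Z' := by
    rw [hun]
    rintro ((h | h) | h)
    exacts [hbQ h, hbX h, hbZ h]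
  rw [Set.mem_union, not_or] at hb
  exact hU.false_of_triangle (habc.subset (by simp)) (habc.subset (by simp))
    (habc.subset (by simp)) (hXX' haX) (Set.mem_singleton b) (hZZ' hcZ) cX'
    (connectedOn_singleton b) cZ' (by simpa using hb.1) dXZ' (by simpa using hb.2)
    (lX.mono subset_rfl hXX').symm lXZ' (lZ.mono subset_rfl hZZ')

end PerimeterTrace

theorem mainTheorem10 {V : Type*} [Finite V] (G : SimpleGraph V) :
    (IsOuterplanarGraph G ↔ IsWing1Graph G) ∧
    (IsOuterplanarGraph G → ∀ L : List V,
      IsPerimeterTrace G {v | v ∈ L} → AppearsInOrder G L →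
      ∃ D : PlaneDrawing G, D.IsWing1 ∧
        (∀ u ∈ L, D.IsOuterVertex u) ∧
        L.Pairwise (fun a b => (D.pos a).re < (D.pos b).re) ∧
        (∀ u ∈ L.head?, D.IsFirst u) ∧
        (2 ≤ L.length → ∀ u ∈ L.getLast?, D.IsLast u)) := by
  have hb : IsOuterplanarGraph G → ∀ L : List V,
      IsPerimeterTrace G {v | v ∈ L} → AppearsInOrder G L →
      ∃ D : PlaneDrawing G, D.IsWing1 ∧
        (∀ u ∈ L, D.IsOuterVertex u) ∧
        L.Pairwise (fun a b => (D.pos a).re < (D.pos b).re) ∧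
        (∀ u ∈ L.head?, D.IsFirst u) ∧
        (2 ≤ L.length → ∀ u ∈ L.getLast?, D.IsLast u) := by
    rintro ⟨D₀, hD₀⟩ L hU hL
    obtain ⟨f, hf, hfL, hfirst, hlast, hcov⟩ :=
      hD₀.outerplanarMinorFree.exists_layout_of_list L univ (fun _ _ => trivial) hL.nodup
        (fun a ha b hb _ => hU.noRootedSquare ha hb univ)
        (fun a b c h Q hQ ha hc => hU.mem_of_sublist hL h hQ ha hc)
    obtain ⟨D, hD, hpos, hcurve⟩ := hf.exists_drawing
    have hre : ∀ v, (D.pos v).re = f v := fun v => by rw [hpos, Complex.ofReal_re]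
    refine ⟨D, hD, fun u hu => ?_, ?_, fun u hu w => ?_, fun h2 u hu w => ?_⟩
    · refine PlaneDrawing.isOuterVertex_of_not_covered (hD.1 u) hD.1 fun e t ht heq => ?_
      obtain ⟨a, b, hab, ha, hb⟩ := hcurve e t ht
      rw [heq, hre] at ha hb
      have := hcov u hu a trivial b trivial hab (by exact_mod_cast ha)
      exact absurd hb (not_lt.2 (by exact_mod_cast this))
    · exact hfL.imp fun {a b} h => by rw [hre, hre]; exact_mod_cast h
    · rw [hre, hre]; exact_mod_cast hfirst u hu w trivial
    · rw [hre, hre]; exact_mod_cast hlast h2 u hu w trivial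
  refine ⟨⟨fun h => ?_, fun ⟨D, hD⟩ => ⟨D, hD.isOuterplanar⟩⟩, hb⟩
  have htrace : IsPerimeterTrace G {v | v ∈ ([] : List V)} := by
    constructor
    · rintro ⟨S, -, hS⟩
      obtain ⟨v, -, hv⟩ := hS 0
      simp at hv
    · rintro ⟨S, -, hS | hS⟩
      all_goals
        obtain ⟨v, -, hv⟩ := hS 0
        simp at hv
  obtain ⟨D, hD, -⟩ := hb h [] htrace ⟨[], rfl, by simp, by simp⟩
  exact ⟨D, hD⟩
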